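/- **Setting.** A Co-MAPF instance consists of a finite undirected graph $G=(V,E)$, a number $k$ of tasks, and $2k$ agents: an initiator $\alpha_i$ and an executor $\beta_i$ for each task $i$. The agents have pairwise distinct start vertices $\sigma(\alpha_i),\sigma(\beta_i)\in V$, and task $i$ has a start vertex $s_i\in V$ and a goal vertex $g_i\in V$. A path of length $|p|$ is a sequence of vertices at times $0,\dots,|p|$ in which each step waits or moves along an edge; afterwards the agent disappears. A meeting is a pair $m=(v,\tau)\in V\times\mathbb N$. A path *performs* the part of $\alpha_i$ with meeting $(v,\tau)$ if it starts at $\sigma(\alpha_i)$, visits $s_i$ at some time $t\le\tau$, and ends in $v$ at time $\tau$; it performs the part of $\beta_i$ if it starts at $\sigma(\beta_i)$, is at $v$ at time $\tau$, and ends in $g_i$ (at some time $\ge\tau$). A conflict is a pair of different agents that are at the same vertex at the same time, except for $\alpha_i,\beta_i$ at the location and time of their meeting, or that traverse the same edge in opposite directions in the same time step. A *solution* is a choice of one path per agent such that, for some meetings $m_1,\dots,m_k$, all paths perform their parts and there is no conflict. Let $V_{ep}$ be the set of all $\sigma(a)$, $s_i$, $g_i$. Two vertices are *connected* if some path of $G$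 between them has no interior vertex in $V_{ep}$. The instance is *well-formed* if for every $i$ (C1) some $v\in V\setminus V_{ep}$ is connected with $s_i$, with $g_i$ and with $\sigma(\beta_i)$, and (C2) $s_i$ is connected with $\sigma(\alpha_i)$. **Algorithm Co-CBS.** With $d$ the graph distance, let $\bar\tau_i(v)=\max\{d(\sigma(\alpha_i),s_i)+d(s_i,v),\,d(\sigma(\beta_i),v)\}$, and let $C_i(v,t)=2t+d(v,g_i)$ if $t\ge\bar\tau_i(v)$ and $C_i(v,t)=\infty$ otherwise. A meetings table for task $i$ stores for each $v$ a time $T(v)$, initially $\bar\tau_i(v)$. *Get-next-meeting* returns $(v,T(v))$ with $C_i(v,T(v))$ minimal (and finite) and replaces $T(v)$ by $T(v)+1$. A node consists of meetings $m_1,\dots,m_k$, a set of constraints (vertex constraints $(a,v,t)$ and edge constraints $(a,u,v,t)$), and one path per agent, where the path of an agent is a shortest one that performs its part with the given meeting and satisfies the constraints on it; the cost of the node is $\sum_i(|p_{\alpha_i}|+|p_{\beta_i}|)$. Nodes are root or regular nodes, and a root node carries the current state of its meetings tables. The search starts with one root node without constraints, whose meetings are the first ones returned by the initial tables. In each iteration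 a node $N$ of lowest cost is removed from the open nodes (regular nodes first among equal cost). If $N$ has no conflict, its paths are returned. Otherwise: - if $N$ is a root node, then for each task $i$ a root node without constraints is added in which $m_i$ is replaced by the next meeting of the table of task $i$ and the paths of $\alpha_i,\beta_i$ are replanned (nothing is added for $i$ if there is no next meeting); - for a first conflict (one of smallest time step) of $N$ and each of its two agents, a regular node is added with the same meetings and the additional constraint that forbids this agent its part in the conflict, the path of this agent being replanned (nothing is added if there is no such path). All remaining ties are broken arbitrarily. **Theorem.** Let a well-formed Co-MAPF instance be given in which no task start vertex $s_i$ is the start vertex of an agent other than $\alpha_i$. Then Co-CBS returns a solution: the initial root node exists, and, however ties are broken, the algorithm never gets stuck or stops with failure, it stops after finitely many iterations, and the paths it returns are a solution of the instance. -/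

import Mathlib

/-- The two kinds of agents: an initiator first visits the start vertex of the task and then goes
to the meeting; an executor goes to the meeting and then to the goal vertex of the task. -/
inductive Role where
  | initiator
  | executor
deriving DecidableEq

/-- The agents of an instance with `k` tasks: `(Role.initiator, i)` and `(Role.executor, i)` are
the two agents assigned to task `i`. -/
abbrev Agent (k : ℕ) : Type := Role × Fin k

/-- A Co-MAPF instance on the undirected graph `G`: `k` tasks, a start and a goal vertex for each of
them, and pairwise distinct start vertices of the `2 * k` agents. -/
structure CoMAPF {V : Type*} (G : SimpleGraph V) where
  k : ℕ
  start : Agent k → V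
  start_injective : Function.Injective start
  taskStart : Fin k → V
  taskGoal : Fin k → V

/-- A single-agent path in discrete time: at each time step the agent waits or moves along an edge.
Only the positions at times `0, …, len` matter; after time `len` the agent has disappeared. -/
structure TimedPath {V : Type*} (G : SimpleGraph V) where
  len : ℕ
  pos : ℕ → V
  step : ∀ t < len, pos t = pos (t + 1) ∨ G.Adj (pos t) (pos (t + 1))

/-- The agent is at `v` at time `t`. -/
def TimedPath.Occupies {V : Type*} {G : SimpleGraph V} (p : TimedPath G) (v : V) (t : ℕ) : Prop :=
  t ≤ p.len ∧ p.pos t = v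

/-- The agent moves from `u` to `v` between time `t` and time `t + 1`. -/
def TimedPath.Traverses {V : Type*} {G : SimpleGraph V} (p : TimedPath G) (u v : V) (t : ℕ) :
    Prop :=
  u ≠ v ∧ t < p.len ∧ p.pos t = u ∧ p.pos (t + 1) = v

/-- A meeting: a location and a time step. -/
structure Meeting (V : Type*) where
  loc : V
  time : ℕ

/-- A conflict between two agents. `vertex a b v t`: both are at `v` at time `t`.
`edge a b u v t`: between `t` and `t + 1`, `a` moves from `u` to `v` and `b` from `v` to `u`. -/
inductive Conflict (V : Type*) (k : ℕ) where
  | vertex (a b : Agent k) (v : V) (t : ℕ)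
  | edge (a b : Agent k) (u v : V) (t : ℕ)

/-- A constraint. `vertex a v t` forbids agent `a` to be at `v` at time `t`;
`edge a u v t` forbids it to move from `u` to `v` between `t` and `t + 1`. -/
inductive Constraint (V : Type*) (k : ℕ) where
  | vertex (a : Agent k) (v : V) (t : ℕ)
  | edge (a : Agent k) (u v : V) (t : ℕ)

namespace Conflict

variable {V : Type*} {k : ℕ}

/-- The time step of a conflict. -/
def time : Conflict V k → ℕ
  | vertex _ _ _ t => t
  | edge _ _ _ _ t => t

/-- The first agent of a conflict. -/
def fstAgent : Conflict V k → Agent k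
  | vertex a _ _ _ => a
  | edge a _ _ _ _ => a

/-- The second agent of a conflict. -/
def sndAgent : Conflict V k → Agent k
  | vertex _ b _ _ => b
  | edge _ b _ _ _ => b

/-- The constraint that a conflict induces on its first agent. -/
def fstConstraint : Conflict V k → Constraint V k
  | vertex a _ v t => .vertex a v t
  | edge a _ u v t => .edge a u v t

/-- The constraint that a conflict induces on its second agent. -/
def sndConstraint : Conflict V k → Constraint V k
  | vertex _ b v t => .vertex b v t
  | edge _ b u v t => .edge b v u t

end Conflict

/-- The path `p` of agent `a` satisfies a constraint (constraints on other agents are void). -/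
def TimedPath.Satisfies {V : Type*} {G : SimpleGraph V} {k : ℕ} (p : TimedPath G) (a : Agent k) :
    Constraint V k → Prop
  | .vertex b v t => b = a → ¬ p.Occupies v t
  | .edge b u v t => b = a → ¬ p.Traverses u v t

namespace CoMAPF

variable {V : Type*} {G : SimpleGraph V}

section Problem

variable (I : CoMAPF G)

/-- The endpoints: start vertices of agents, start and goal vertices of tasks. -/
def endpoints : Set V :=
  Set.range I.start ∪ Set.range I.taskStart ∪ Set.range I.taskGoal

/-- Two vertices are connected if some path between them has no endpoint of the instance in its
interior. -/
def ConnectedVia (u v : V) : Prop :=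
  ∃ w : G.Walk u v, w.IsPath ∧ ∀ x ∈ w.support, x = u ∨ x = v ∨ x ∉ I.endpoints

/-- Well-formed instances: conditions (C1) and (C2). -/
def WellFormed : Prop :=
  (∀ i : Fin I.k, ∃ v : V, v ∉ I.endpoints ∧
    I.ConnectedVia v (I.taskStart i) ∧
    I.ConnectedVia v (I.taskGoal i) ∧
    I.ConnectedVia v (I.start (Role.executor, i))) ∧
  (∀ i : Fin I.k, I.ConnectedVia (I.taskStart i) (I.start (Role.initiator, i)))

/-- The path `p` lets agent `a` do its part of its task, with meeting `m`. -/
def Performs (m : Meeting V) (p : TimedPath G) : Agent I.k → Prop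
  | (Role.initiator, i) =>
      p.pos 0 = I.start (Role.initiator, i) ∧
      (∃ t ≤ m.time, p.pos t = I.taskStart i) ∧
      p.len = m.time ∧ p.pos m.time = m.loc
  | (Role.executor, i) =>
      p.pos 0 = I.start (Role.executor, i) ∧
      m.time ≤ p.len ∧ p.pos m.time = m.loc ∧
      p.pos p.len = I.taskGoal i

/-- `c` is a conflict between the paths `P`, given the meetings `M`. Two agents that share a task
are allowed to be together at the location and the time of their meeting. -/
def HasConflict (M : Fin I.k → Meeting V) (P : Agent I.k → TimedPath G) :
    Conflict V I.k → Prop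
  | .vertex a b v t =>
      a ≠ b ∧ (P a).Occupies v t ∧ (P b).Occupies v t ∧
      ¬ (a.2 = b.2 ∧ v = (M a.2).loc ∧ t = (M a.2).time)
  | .edge a b u v t =>
      a ≠ b ∧ (P a).Traverses u v t ∧ (P b).Traverses v u t

/-- Feasible solutions of the instance: for suitable meetings, all agents perform their parts and
there is no conflict. -/
def IsSolution (P : Agent I.k → TimedPath G) : Prop :=
  ∃ M : Fin I.k → Meeting V,
    (∀ a : Agent I.k, I.Performs (M a.2) (P a) a) ∧ ∀ c, ¬ I.HasConflict M P c

/-- Sum of costs. -/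
def soc (P : Agent I.k → TimedPath G) : ℕ :=
  ∑ i : Fin I.k, ((P (Role.initiator, i)).len + (P (Role.executor, i)).len)

end Problem

section Algorithm

variable (I : CoMAPF G)

/-- The earliest time at which both agents of task `i` can be at `v` (`⊤` if they cannot). -/
noncomputable def earliest (i : Fin I.k) (v : V) : ℕ∞ :=
  max (G.edist (I.start (Role.initiator, i)) (I.taskStart i) + G.edist (I.taskStart i) v)
    (G.edist (I.start (Role.executor, i)) v)

open Classical in
/-- The cost of a meeting of task `i` at vertex `v` and time `t`. -/
noncomputable def meetingCost (i : Fin I.k) (v : V) (t : ℕ∞) : ℕ∞ :=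
  if I.earliest i v ≤ t then 2 * t + G.edist v (I.taskGoal i) else ⊤

/-- The operation get-next-meeting on the meetings table of task `i`. A table `T` stores for each
vertex `v` the time `T v` of the next meeting there, whose cost is `meetingCost i v (T v)`. A meeting
`m` of lowest cost (which has to be finite) is returned, and in the new table `T'` the time at its
vertex is increased by one. -/
def NextMeeting (i : Fin I.k) (T : V → ℕ∞) (m : Meeting V) (T' : V → ℕ∞) : Prop :=
  T m.loc = m.time ∧
  I.meetingCost i m.loc (T m.loc) < ⊤ ∧
  (∀ v, I.meetingCost i m.loc (T m.loc) ≤ I.meetingCost i v (T v)) ∧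
  T' m.loc = T m.loc + 1 ∧ ∀ v, v ≠ m.loc → T' v = T v

/-- The paths level: `p` is a shortest path for agent `a` among those that perform its part of the
task with meeting `m` and satisfy the constraints `K`. -/
def IsPlan (m : Meeting V) (K : Set (Constraint V I.k)) (a : Agent I.k) (p : TimedPath G) : Prop :=
  (I.Performs m p a ∧ ∀ κ ∈ K, p.Satisfies a κ) ∧
  ∀ q : TimedPath G, I.Performs m q a → (∀ κ ∈ K, q.Satisfies a κ) → p.len ≤ q.len

/-- Nodes of the search forest. The field `tables` holds the current state of the meetings tables
(it is used for root nodes only). -/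
structure Node where
  constraints : Set (Constraint V I.k)
  meetings : Fin I.k → Meeting V
  tables : Fin I.k → V → ℕ∞
  isRoot : Bool
  paths : Agent I.k → TimedPath G

variable {I}

/-- The cost of a node is the sum of costs of its paths. -/
def Node.cost (N : I.Node) : ℕ := I.soc N.paths

/-- `c` is a conflict of the node. -/
def Node.HasConflict (N : I.Node) (c : Conflict V I.k) : Prop :=
  I.HasConflict N.meetings N.paths c

/-- `c` is a first conflict of the node: no conflict has an earlier time step. -/
def Node.IsFirstConflict (N : I.Node) (c : Conflict V I.k) : Prop :=
  N.HasConflict c ∧ ∀ c', N.HasConflict c' → c.time ≤ c'.time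

/-- An initial root node: the first meeting of each initial table, no constraints. -/
def IsInitialRoot (R : I.Node) : Prop :=
  R.constraints = ∅ ∧
  (∀ i, I.NextMeeting i (I.earliest i) (R.meetings i) (R.tables i)) ∧
  R.isRoot = true ∧
  ∀ a : Agent I.k, I.IsPlan (R.meetings a.2) ∅ a (R.paths a)

/-- `R` is obtained from the root node `N` by moving task `i` to its next meeting and replanning for
the two agents of task `i`. -/
def IsRootSuccessor (N : I.Node) (i : Fin I.k) (R : I.Node) : Prop :=
  R.constraints = ∅ ∧
  I.NextMeeting i (N.tables i) (R.meetings i) (R.tables i) ∧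
  (∀ j, j ≠ i → R.meetings j = N.meetings j ∧ R.tables j = N.tables j) ∧
  R.isRoot = true ∧
  ∀ a : Agent I.k,
    (a.2 = i → I.IsPlan (R.meetings i) ∅ a (R.paths a)) ∧ (a.2 ≠ i → R.paths a = N.paths a)

/-- `A` is obtained from `N` by adding the constraint `κ` and replanning for agent `a`. -/
def IsSplitSuccessor (N : I.Node) (a : Agent I.k) (κ : Constraint V I.k) (A : I.Node) : Prop :=
  A.constraints = insert κ N.constraints ∧
  A.meetings = N.meetings ∧
  A.tables = N.tables ∧
  A.isRoot = false ∧
  I.IsPlan (N.meetings a.2) A.constraints a (A.paths a) ∧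
  ∀ b, b ≠ a → A.paths b = N.paths b

/-- `S` consists of one node with the property `Q`, or is empty if there is no such node. -/
def OneIfPossible (Q : I.Node → Prop) (S : Multiset I.Node) : Prop :=
  (∃ A, Q A ∧ S = {A}) ∨ ((¬ ∃ A, Q A) ∧ S = 0)

/-- `S` is a possible result of expanding the root node `N` in the meetings space. -/
def ExpandRoot (N : I.Node) (S : Multiset I.Node) : Prop :=
  ∃ F : Fin I.k → Multiset I.Node,
    (∀ i, OneIfPossible (IsRootSuccessor N i) (F i)) ∧ S = ∑ i, F i

/-- `S` is a possible result of splitting the node `N` on the conflict `c`. -/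
def Split (N : I.Node) (c : Conflict V I.k) (S : Multiset I.Node) : Prop :=
  ∃ S₁ S₂ : Multiset I.Node,
    OneIfPossible (IsSplitSuccessor N c.fstAgent c.fstConstraint) S₁ ∧
    OneIfPossible (IsSplitSuccessor N c.sndAgent c.sndConstraint) S₂ ∧
    S = S₁ + S₂

variable (I) in
/-- States of the algorithm: the loop with its two lists of regular and of root nodes, or the
end of the run with the paths that are returned. -/
inductive State where
  | searching (reg roots : Multiset I.Node)
  | returned (P : Agent I.k → TimedPath G)

/-- `N` is a lowest-cost node of the two lists, where regular nodes have priority over root nodes of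
equal cost; `reg'` and `roots'` are the lists without `N`. -/
def Selects (reg roots : Multiset I.Node) (N : I.Node) (reg' roots' : Multiset I.Node) : Prop :=
  (reg = N ::ₘ reg' ∧ roots' = roots ∧
    (∀ N' ∈ reg, N.cost ≤ N'.cost) ∧ ∀ N' ∈ roots, N.cost ≤ N'.cost) ∨
  (roots = N ::ₘ roots' ∧ reg' = reg ∧
    (∀ N' ∈ roots, N.cost ≤ N'.cost) ∧ ∀ N' ∈ reg, N.cost < N'.cost)

variable (I) in
/-- One iteration of the main loop. Ties are broken arbitrarily. -/
inductive Step : I.State → I.State → Prop where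
  | finish {reg roots reg' roots' : Multiset I.Node} {N : I.Node}
      (hsel : Selects reg roots N reg' roots')
      (hgoal : ∀ c, ¬ N.HasConflict c) :
      Step (.searching reg roots) (.returned N.paths)
  | expand {reg roots reg' roots' newReg newRoots : Multiset I.Node} {N : I.Node}
      {c : Conflict V I.k}
      (hsel : Selects reg roots N reg' roots')
      (hc : N.IsFirstConflict c)
      (hroots : (N.isRoot = true ∧ ExpandRoot N newRoots) ∨ (N.isRoot = false ∧ newRoots = 0))
      (hsplit : Split N c newReg) :
      Step (.searching reg roots) (.searching (reg' + newReg) (roots' + newRoots))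

variable (I) in
/-- Initial states: the list of root nodes holds exactly an initial root node. -/
def IsInitialState (s : I.State) : Prop :=
  ∃ R : I.Node, IsInitialRoot R ∧ s = .searching 0 {R}

end Algorithm

end CoMAPF

/-!
The algorithm is a best-first search. It terminates with a solution as soon as one exists, and
well-formed instances have one.

*Existence of a solution* (`CoMAPF.WellFormed.exists_isSolution`). Agents move one at a time while
all others wait at start vertices of agents. By well-formedness, the task start vertex, both agent
starts and the goal of task `i` are joined by walks that avoid all agents of other tasks, except
possibly at the goal (`CoMAPF.WellFormed.exists_hub`). First each initiator walks to the task start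
vertex and on to the start of its executor, meets it there and disappears. Then only the executors
are left. If the goal of the next executor `i` is occupied by the executor of task `j`, the latter
changes over to the other one of the two agent starts of task `j`, which is free at that time; then
`i` goes to its goal (`CoMAPF.WellFormed.canFinish`). The schedule is built backwards: a walk of one
agent is put in front of its path, and the paths of all other agents are delayed by its length
(`CoMAPF.NoConflictOn.prependMove`).

*Completeness.* Fix a solution with meetings `M` and paths `P`. At any time some open node `N` leads
to it (`CoMAPF.Node.LeadsTo`): either `N` has the meetings `M` and constraints that `P` satisfies,
or `N` is a root node and each meeting of `M` is in `N` or still ahead in its meetings table, which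
returns meetings in the order of their cost. The property passes to a successor
(`CoMAPF.Node.LeadsTo.exists_successor`), because tables skip no meeting and `P`, being free of
conflicts, satisfies one of the two constraints of a split. The cost of such a node is at most the
cost `C` of `P`, so all selected nodes have cost at most `C`. In particular the algorithm never runs
out of nodes.

*Termination.* A conflict of a node of cost at most `C` happens at a time at most `C`, and it adds a
constraint that is new, since the paths of the node satisfy the old ones. Likewise a root successor
of cost at most `C` uses up a meeting of time at most `C`. There are finitely many such constraints
and meetings, so the search is bounded in depth (`CoMAPF.Node.depth`), and a weight exponential in
the depth, summed over the open nodes, decreases in each iteration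
(`CoMAPF.Node.Valid.sum_weight_lt`).
-/

/-! ### Timed paths -/

namespace TimedPath

variable {V : Type*} {G : SimpleGraph V}

/-- The path of length `0` at the vertex `v`. -/
def stay (G : SimpleGraph V) (v : V) : TimedPath G where
  len := 0
  pos := fun _ => v
  step := fun _ h => absurd h (Nat.not_lt_zero _)

/-- Wait for `n` time steps at the first vertex of `p`, then follow `p`. For `t < n` the truncated
subtraction gives the position `p.pos 0`. -/
def delay (n : ℕ) (p : TimedPath G) : TimedPath G where
  len := n + p.len
  pos := fun t => p.pos (t - n)
  step := by
    intro t ht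
    rcases Nat.lt_or_ge t n with h | h
    · left
      rw [Nat.sub_eq_zero_of_le h.le, Nat.sub_eq_zero_of_le h]
    · rw [Nat.sub_add_comm h]
      exact p.step _ (by omega)

/-- Follow the walk `w` to the first vertex of `p` without waiting, then follow `p`. -/
def prepend {x y : V} (w : G.Walk x y) (p : TimedPath G) (h : p.pos 0 = y) : TimedPath G where
  len := w.length + p.len
  pos := fun t => if t < w.length then w.getVert t else p.pos (t - w.length)
  step := by
    intro t ht
    rcases Nat.lt_trichotomy (t + 1) w.length with h' | h' | h'
    · right
      rw [if_pos (by omega), if_pos h']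
      exact w.adj_getVert_succ (by omega)
    · right
      have hadj := w.adj_getVert_succ (i := t) (by omega)
      rw [h', w.getVert_length] at hadj
      rwa [if_pos (by omega), if_neg (by omega), h', Nat.sub_self, h]
    · rw [if_neg (by omega), if_neg (by omega), Nat.sub_add_comm (by omega)]
      exact p.step _ (by omega)

@[simp] lemma len_delay (n : ℕ) (p : TimedPath G) : (p.delay n).len = n + p.len := rfl

lemma pos_delay_add (n : ℕ) (p : TimedPath G) (t : ℕ) : (p.delay n).pos (n + t) = p.pos t := by
  simp [delay]

lemma pos_delay_of_le {n : ℕ} (p : TimedPath G) {t : ℕ} (h : t ≤ n) :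
    (p.delay n).pos t = p.pos 0 := by
  simp [delay, Nat.sub_eq_zero_of_le h]

section prepend

variable {x y : V} (w : G.Walk x y) (p : TimedPath G) (h : p.pos 0 = y)

@[simp] lemma len_prepend : (prepend w p h).len = w.length + p.len := rfl

lemma pos_prepend_add (t : ℕ) : (prepend w p h).pos (w.length + t) = p.pos t := by
  simp [prepend]

lemma pos_prepend_of_lt {t : ℕ} (ht : t < w.length) : (prepend w p h).pos t = w.getVert t := by
  simp [prepend, ht]

lemma pos_prepend_length : (prepend w p h).pos w.length = y := by
  simpa [h] using pos_prepend_add w p h 0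

lemma pos_prepend_zero : (prepend w p h).pos 0 = x := by
  rcases Nat.eq_zero_or_pos w.length with h0 | h0
  · have hw := pos_prepend_length w p h
    rw [h0] at hw
    rw [hw]
    exact (SimpleGraph.Walk.eq_of_length_eq_zero h0).symm
  · rw [pos_prepend_of_lt w p h h0, w.getVert_zero]

lemma pos_prepend_of_le {t : ℕ} (ht : t ≤ w.length) : (prepend w p h).pos t = w.getVert t := by
  rcases ht.lt_or_eq with ht | rfl
  · exact pos_prepend_of_lt w p h ht
  · rw [pos_prepend_length, w.getVert_length]

end prepend

lemma edist_pos_le (p : TimedPath G) (s n : ℕ) (hn : s + n ≤ p.len) :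
    G.edist (p.pos s) (p.pos (s + n)) ≤ n := by
  induction n with
  | zero => simp
  | succ n ih =>
    refine (G.edist_triangle (v := p.pos (s + n))).trans ?_
    rw [Nat.cast_succ]
    refine add_le_add (ih (by omega)) ?_
    rcases p.step (s + n) (by omega) with h | h
    · rw [← add_assoc, ← h]
      simp
    · exact (SimpleGraph.edist_eq_one_iff_adj.mpr h).le

end TimedPath

namespace CoMAPF

variable {V : Type*} {G : SimpleGraph V} (I : CoMAPF G)

/-! ### Moving one agent while all others wait -/

/-- There is no conflict between two agents of the set `S`. -/
def NoConflictOn (M : Fin I.k → Meeting V) (P : Agent I.k → TimedPath G)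
    (S : Set (Agent I.k)) : Prop :=
  ∀ c : Conflict V I.k, c.fstAgent ∈ S → c.sndAgent ∈ S → ¬ I.HasConflict M P c

/-- All meetings are postponed by `n` time steps. -/
def shiftMeetings (n : ℕ) (M : Fin I.k → Meeting V) (i : Fin I.k) : Meeting V :=
  ⟨(M i).loc, n + (M i).time⟩

variable {I}

/-- Only the meetings of tasks that have both agents in `S` matter for the conflicts on `S`. -/
lemma NoConflictOn.congr_meetings {M M' : Fin I.k → Meeting V} {P : Agent I.k → TimedPath G}
    {S : Set (Agent I.k)} (h : I.NoConflictOn M P S)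
    (hM : ∀ a ∈ S, ∀ b ∈ S, a ≠ b → a.2 = b.2 → M a.2 = M' a.2) : I.NoConflictOn M' P S := by
  rintro (⟨a, b, v, t⟩ | ⟨a, b, u, v, t⟩) ha hb hc
  · obtain ⟨hab, h1, h2, h3⟩ := hc
    refine h (.vertex a b v t) ha hb ⟨hab, h1, h2, fun ⟨h4, h5⟩ => h3 ⟨h4, ?_⟩⟩
    rwa [← hM a ha b hb hab h4]
  · exact h (.edge a b u v t) ha hb hc

open Classical in
/-- Agent `i` follows the walk `w` before its path, and all other agents wait meanwhile. -/
noncomputable def prependMove (P : Agent I.k → TimedPath G) (i : Agent I.k) {x y : V}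
    (w : G.Walk x y) (h : (P i).pos 0 = y) (a : Agent I.k) : TimedPath G :=
  if a = i then TimedPath.prepend w (P i) h else (P a).delay w.length

section prependMove

variable (P : Agent I.k → TimedPath G) (i : Agent I.k) {x y : V} (w : G.Walk x y)
  (h : (P i).pos 0 = y)

lemma prependMove_self : prependMove P i w h i = TimedPath.prepend w (P i) h := by
  simp [prependMove]

lemma prependMove_of_ne {a : Agent I.k} (ha : a ≠ i) :
    prependMove P i w h a = (P a).delay w.length := by
  simp [prependMove, ha]

lemma len_prependMove (a : Agent I.k) : (prependMove P i w h a).len = w.length + (P a).len := by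
  unfold prependMove
  split_ifs with ha
  · rw [ha]; rfl
  · rfl

lemma pos_prependMove_add (a : Agent I.k) (t : ℕ) :
    (prependMove P i w h a).pos (w.length + t) = (P a).pos t := by
  unfold prependMove
  split_ifs with ha
  · rw [ha, TimedPath.pos_prepend_add]
  · rw [TimedPath.pos_delay_add]

lemma pos_len_prependMove (a : Agent I.k) :
    (prependMove P i w h a).pos (prependMove P i w h a).len = (P a).pos (P a).len := by
  rw [len_prependMove, pos_prependMove_add]

lemma pos_prependMove_of_ne {a : Agent I.k} (ha : a ≠ i) {t : ℕ} (ht : t ≤ w.length) :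
    (prependMove P i w h a).pos t = (P a).pos 0 := by
  rw [prependMove_of_ne P i w h ha, TimedPath.pos_delay_of_le _ ht]

lemma pos_prependMove_self_zero : (prependMove P i w h i).pos 0 = x := by
  rw [prependMove_self, TimedPath.pos_prepend_zero]

lemma pos_prependMove_self_of_lt {t : ℕ} (ht : t < w.length) :
    (prependMove P i w h i).pos t = w.getVert t := by
  rw [prependMove_self, TimedPath.pos_prepend_of_lt _ _ _ ht]

/-- The walk may end in the position of another agent: that collision, if it is one, is already
present in the paths `P` at time `0`. -/
lemma NoConflictOn.prependMove {M : Fin I.k → Meeting V} {S : Set (Agent I.k)}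
    (hP : I.NoConflictOn M P S)
    (hinj : ∀ a ∈ S, ∀ b ∈ S, a ≠ b → a ≠ i → b ≠ i → (P a).pos 0 ≠ (P b).pos 0)
    (hw : ∀ b ∈ S, b ≠ i → ∀ t < w.length, w.getVert t ≠ (P b).pos 0) :
    I.NoConflictOn (I.shiftMeetings w.length M) (CoMAPF.prependMove P i w h) S := by
  rintro (⟨a, b, v, t⟩ | ⟨a, b, u, v, t⟩) ha hb hc
  · obtain ⟨hab, ⟨h1, h2⟩, ⟨h3, h4⟩, h5⟩ := hc
    change a ∈ S at ha
    change b ∈ S at hb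
    rcases Nat.lt_or_ge t w.length with ht | ht
    · by_cases hai : a = i
      · have hbi : b ≠ i := fun hbi => hab (hai.trans hbi.symm)
        rw [pos_prependMove_of_ne P i w h hbi ht.le] at h4
        rw [hai, pos_prependMove_self_of_lt P i w h ht] at h2
        exact hw b hb hbi t ht (h2.trans h4.symm)
      · rw [pos_prependMove_of_ne P i w h hai ht.le] at h2
        by_cases hbi : b = i
        · rw [hbi, pos_prependMove_self_of_lt P i w h ht] at h4
          exact hw a ha hai t ht (h4.trans h2.symm)
        · rw [pos_prependMove_of_ne P i w h hbi ht.le] at h4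
          exact hinj a ha b hb hab hai hbi (h2.trans h4.symm)
    · obtain ⟨s, rfl⟩ := Nat.exists_eq_add_of_le ht
      rw [len_prependMove] at h1 h3
      rw [pos_prependMove_add] at h2 h4
      refine hP (.vertex a b v s) ha hb
        ⟨hab, ⟨by omega, h2⟩, ⟨by omega, h4⟩, fun ⟨h6, h7, h8⟩ => h5 ⟨h6, h7, ?_⟩⟩
      rw [h8]; rfl
  · obtain ⟨hab, ⟨huv, h1, h2, h3⟩, ⟨-, h4, h5, h6⟩⟩ := hc
    rcases Nat.lt_or_ge t w.length with ht | ht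
    · by_cases hai : a = i
      · have hbi : b ≠ i := fun hbi => hab (hai.trans hbi.symm)
        rw [pos_prependMove_of_ne P i w h hbi ht.le] at h5
        rw [pos_prependMove_of_ne P i w h hbi ht] at h6
        exact huv (h6.symm.trans h5)
      · rw [pos_prependMove_of_ne P i w h hai ht.le] at h2
        rw [pos_prependMove_of_ne P i w h hai ht] at h3
        exact huv (h2.symm.trans h3)
    · obtain ⟨s, rfl⟩ := Nat.exists_eq_add_of_le ht
      rw [len_prependMove] at h1 h4
      rw [add_assoc, pos_prependMove_add] at h3 h6
      rw [pos_prependMove_add] at h2 h5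
      exact hP (.edge a b u v s) ha hb ⟨hab, ⟨huv, by omega, h2, h3⟩, ⟨huv.symm, by omega, h5, h6⟩⟩

end prependMove

/-- A path of length `0` can be added to the paths of the agents in `S` if nobody else is at its
vertex at time `0`, except for a meeting. -/
lemma NoConflictOn.insert_stay {M : Fin I.k → Meeting V} {P : Agent I.k → TimedPath G}
    {S : Set (Agent I.k)} (hP : I.NoConflictOn M P S) {i : Agent I.k} (hi : (P i).len = 0)
    (hpos : ∀ b ∈ S, b ≠ i → (P b).pos 0 = (P i).pos 0 →
      b.2 = i.2 ∧ M i.2 = ⟨(P i).pos 0, 0⟩) :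
    I.NoConflictOn M P (insert i S) := by
  rintro (⟨a, b, v, t⟩ | ⟨a, b, u, v, t⟩) ha hb hc
  · have hc' := hc
    obtain ⟨hab, ⟨h1, h2⟩, ⟨h3, h4⟩, h5⟩ := hc
    rcases ha with ha | ha <;> rcases hb with hb | hb
    · exact hab (ha.trans hb.symm)
    · change a = i at ha
      subst ha
      obtain rfl : t = 0 := by omega
      obtain ⟨h6, h7⟩ := hpos b hb hab.symm (h4.trans h2.symm)
      exact h5 ⟨h6.symm, by rw [h7]; exact h2.symm, by rw [h7]⟩
    · change b = i at hb
      subst hb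
      obtain rfl : t = 0 := by omega
      obtain ⟨h6, h7⟩ := hpos a ha hab (h2.trans h4.symm)
      exact h5 ⟨h6, by rw [h6, h7]; exact h4.symm, by rw [h6, h7]⟩
    · exact hP (.vertex a b v t) ha hb hc'
  · have hc' := hc
    obtain ⟨hab, ⟨huv, h1, h2, h3⟩, ⟨-, h4, h5, h6⟩⟩ := hc
    rcases ha with ha | ha
    · change a = i at ha
      subst ha
      omega
    · rcases hb with hb | hb
      · change b = i at hb
        subst hb
        omega
      · exact hP (.edge a b u v t) ha hb hc'

/-- The paths of agents outside of `S` are irrelevant. -/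
lemma NoConflictOn.congr_paths {M : Fin I.k → Meeting V} {P P' : Agent I.k → TimedPath G}
    {S : Set (Agent I.k)} (h : I.NoConflictOn M P S) (hP : ∀ a ∈ S, P a = P' a) :
    I.NoConflictOn M P' S := by
  rintro (⟨a, b, v, t⟩ | ⟨a, b, u, v, t⟩) ha hb hc
  · refine h (.vertex a b v t) ha hb ?_
    simp only [HasConflict] at hc ⊢
    rwa [hP a ha, hP b hb]
  · refine h (.edge a b u v t) ha hb ?_
    simp only [HasConflict] at hc ⊢
    rwa [hP a ha, hP b hb]

/-! ### Walks in well-formed instances -/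

variable (I) in
/-- Vertices that agents of task `i` can use while all agents of other tasks are at start vertices
of agents: vertices that are no endpoints, the task start vertex, and the starts of both agents. -/
def Private (i : Fin I.k) (x : V) : Prop :=
  x ∉ I.endpoints ∨ x = I.taskStart i ∨ ∃ r, x = I.start (r, i)

lemma start_mem_endpoints (a : Agent I.k) : I.start a ∈ I.endpoints :=
  Or.inl (Or.inl ⟨a, rfl⟩)

/-- A private vertex of task `i` is not the start of an agent of another task. -/
lemma Private.eq_of_start
    (hstart : ∀ (i : Fin I.k) (a : Agent I.k),
      I.start a = I.taskStart i → a = (Role.initiator, i))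
    {i : Fin I.k} {a : Agent I.k} (h : I.Private i (I.start a)) : a.2 = i := by
  rcases h with h | h | ⟨r, h⟩
  · exact absurd (start_mem_endpoints a) h
  · rw [hstart i a h]
  · rw [I.start_injective h]

/-- Some vertex `v` is joined to the task start vertex and to the starts of both agents of task `i`
by walks along private vertices, and to the goal vertex by a walk whose other vertices are private.
The goal vertex itself may be the start of an agent of another task. -/
lemma WellFormed.exists_hub (hwf : I.WellFormed) (i : Fin I.k) :
    ∃ v : V, (∀ r, ∃ w : G.Walk v (I.start (r, i)), ∀ x ∈ w.support, I.Private i x) ∧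
      (∃ w : G.Walk v (I.taskGoal i), ∀ x ∈ w.support, I.Private i x ∨ x = I.taskGoal i) ∧
      ∃ w : G.Walk v (I.taskStart i), ∀ x ∈ w.support, I.Private i x := by
  obtain ⟨v, hv, ⟨w₁, -, h₁⟩, ⟨w₂, -, h₂⟩, ⟨w₃, -, h₃⟩⟩ := hwf.1 i
  obtain ⟨w₄, -, h₄⟩ := hwf.2 i
  have hw₁ : ∀ x ∈ w₁.support, I.Private i x := by
    intro x hx
    rcases h₁ x hx with rfl | h | h
    exacts [Or.inl hv, Or.inr (Or.inl h), Or.inl h]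
  refine ⟨v, ?_, ⟨w₂, ?_⟩, w₁, hw₁⟩
  · rintro (_ | _)
    · refine ⟨w₁.append w₄, fun x hx => ?_⟩
      rcases (SimpleGraph.Walk.mem_support_append_iff _ _).mp hx with hx | hx
      · exact hw₁ x hx
      · rcases h₄ x hx with h | h | h
        exacts [Or.inr (Or.inl h), Or.inr (Or.inr ⟨_, h⟩), Or.inl h]
    · refine ⟨w₃, fun x hx => ?_⟩
      rcases h₃ x hx with rfl | h | h
      exacts [Or.inl hv, Or.inr (Or.inr ⟨_, h⟩), Or.inl h]
  · intro x hx
    rcases h₂ x hx with rfl | h | h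
    exacts [Or.inl (Or.inl hv), Or.inr h, Or.inl (Or.inl h)]

lemma WellFormed.exists_walk_start (hwf : I.WellFormed) (i : Fin I.k) (r r' : Role) :
    ∃ w : G.Walk (I.start (r, i)) (I.start (r', i)), ∀ x ∈ w.support, I.Private i x := by
  obtain ⟨v, h, -, -⟩ := hwf.exists_hub i
  obtain ⟨w, hw⟩ := h r
  obtain ⟨w', hw'⟩ := h r'
  refine ⟨w.reverse.append w', fun x hx => ?_⟩
  rcases (SimpleGraph.Walk.mem_support_append_iff _ _).mp hx with hx | hx
  · exact hw x (by simpa using hx)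
  · exact hw' x hx

lemma WellFormed.exists_walk_goal (hwf : I.WellFormed) (i : Fin I.k) (r : Role) :
    ∃ w : G.Walk (I.start (r, i)) (I.taskGoal i),
      ∀ x ∈ w.support, I.Private i x ∨ x = I.taskGoal i := by
  obtain ⟨v, h, ⟨w', hw'⟩, -⟩ := hwf.exists_hub i
  obtain ⟨w, hw⟩ := h r
  refine ⟨w.reverse.append w', fun x hx => ?_⟩
  rcases (SimpleGraph.Walk.mem_support_append_iff _ _).mp hx with hx | hx
  · exact Or.inl (hw x (by simpa using hx))
  · exact hw' x hx

/-- The walk of an initiator to the start of its executor via the task start vertex, which reaches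
the executor only at its end. -/
lemma WellFormed.exists_walk_meeting (hwf : I.WellFormed)
    (hstart : ∀ (i : Fin I.k) (a : Agent I.k),
      I.start a = I.taskStart i → a = (Role.initiator, i)) (i : Fin I.k) :
    ∃ w : G.Walk (I.start (Role.initiator, i)) (I.start (Role.executor, i)),
      (∀ x ∈ w.support, I.Private i x) ∧ I.taskStart i ∈ w.support ∧
      ∀ t < w.length, w.getVert t ≠ I.start (Role.executor, i) := by
  classical
  obtain ⟨v, hv, -, w₁, hw₁⟩ := hwf.exists_hub i
  obtain ⟨w₂, hw₂⟩ := hv Role.executor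
  obtain ⟨w₃, -, hw₃⟩ := hwf.2 i
  have hne : I.start (Role.executor, i) ≠ I.taskStart i := fun h => by
    simpa using hstart i _ h
  -- The initial part up to the task start vertex avoids the executor; the rest is a path.
  let q := (w₁.reverse.append w₂).toPath
  have hq : ∀ x ∈ q.1.support, I.Private i x := by
    intro x hx
    have hx := SimpleGraph.Walk.support_bypass_subset_support _ hx
    rcases (SimpleGraph.Walk.mem_support_append_iff _ _).mp hx with hx | hx
    · exact hw₁ x (by simpa using hx)
    · exact hw₂ x hx
  refine ⟨w₃.reverse.append q.1, fun x hx => ?_, ?_, fun t ht heq => ?_⟩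
  · rcases (SimpleGraph.Walk.mem_support_append_iff _ _).mp hx with hx | hx
    · rcases hw₃ x (by simpa using hx) with h | h | h
      exacts [Or.inr (Or.inl h), Or.inr (Or.inr ⟨_, h⟩), Or.inl h]
    · exact hq x hx
  · exact (SimpleGraph.Walk.mem_support_append_iff _ _).mpr (Or.inl (w₃.reverse.end_mem_support))
  · rw [SimpleGraph.Walk.getVert_append] at heq
    split_ifs at heq with h
    · have hmem : I.start (Role.executor, i) ∈ w₃.support := by
        have := w₃.reverse.getVert_mem_support t
        rw [heq] at this
        simpa using this
      rcases hw₃ _ hmem with h' | h' | h'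
      · exact hne h'
      · simpa using I.start_injective h'
      · exact h' (start_mem_endpoints _)
    · rw [SimpleGraph.Walk.length_append] at ht
      have hle : t - w₃.reverse.length ≤ q.1.length := by omega
      have := q.2.getVert_injOn hle (le_refl q.1.length)
        (by rw [heq, SimpleGraph.Walk.getVert_length])
      omega

/-! ### Existence of a solution -/

/-- The executors of the tasks in `S`. -/
def executors {k : ℕ} (S : Finset (Fin k)) : Set (Agent k) :=
  {a | a.1 = Role.executor ∧ a.2 ∈ S}

variable (I) in
/-- The executors of the tasks in `S` can all go to their goals without conflicts, if the executor
of task `j` is at the start vertex of the agent `(c j, j)`. -/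
def CanFinish (S : Finset (Fin I.k)) (c : Fin I.k → Role) : Prop :=
  ∃ (M : Fin I.k → Meeting V) (P : Agent I.k → TimedPath G),
    (∀ j ∈ S, (P (Role.executor, j)).pos 0 = I.start (c j, j) ∧
      (P (Role.executor, j)).pos (P (Role.executor, j)).len = I.taskGoal j) ∧
    I.NoConflictOn M P (executors S)

lemma injective_start_config (c : Fin I.k → Role) {j j' : Fin I.k} (h : j ≠ j') :
    I.start (c j, j) ≠ I.start (c j', j') := fun he =>
  h (congrArg Prod.snd (I.start_injective he))

lemma CanFinish.pos_zero_ne {S : Finset (Fin I.k)} {c : Fin I.k → Role}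
    {P : Agent I.k → TimedPath G}
    (h : ∀ j ∈ S, (P (Role.executor, j)).pos 0 = I.start (c j, j)) :
    ∀ a ∈ executors S, ∀ b ∈ executors S, a ≠ b → (P a).pos 0 ≠ (P b).pos 0 := by
  rintro ⟨_, j⟩ ⟨rfl, hj⟩ ⟨_, j'⟩ ⟨rfl, hj'⟩ hne
  rw [h j hj, h j' hj']
  exact injective_start_config c (fun he => hne (by rw [he]))

/-- An executor may first move between the start vertices of the two agents of its task. -/
lemma CanFinish.of_update (hwf : I.WellFormed)
    (hstart : ∀ (i : Fin I.k) (a : Agent I.k),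
      I.start a = I.taskStart i → a = (Role.initiator, i))
    {S : Finset (Fin I.k)} {c : Fin I.k → Role} (j : Fin I.k) (r : Role)
    (hc : I.CanFinish S (Function.update c j r)) : I.CanFinish S c := by
  obtain ⟨M, P, hP, hconf⟩ := hc
  by_cases hj : j ∈ S
  · obtain ⟨w, hw⟩ := hwf.exists_walk_start j (c j) r
    have h0 : (P (Role.executor, j)).pos 0 = I.start (r, j) := by
      simpa using (hP j hj).1
    refine ⟨_, prependMove P (Role.executor, j) w h0, fun l hl => ⟨?_, ?_⟩,
      hconf.prependMove P _ w h0
        (fun a ha b hb hab _ _ => CanFinish.pos_zero_ne (fun j hj => (hP j hj).1) a ha b hb hab) ?_⟩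
    · by_cases hlj : l = j
      · rw [hlj, pos_prependMove_self_zero]
      · rw [pos_prependMove_of_ne _ _ _ _ (by simpa using hlj) (Nat.zero_le _), (hP l hl).1,
          Function.update_of_ne hlj]
    · rw [pos_len_prependMove, (hP l hl).2]
    · rintro ⟨_, l⟩ ⟨rfl, hl⟩ hne t - heq
      have hpriv := hw _ (w.getVert_mem_support t)
      rw [heq, (hP l hl).1] at hpriv
      exact hne (by rw [← hpriv.eq_of_start hstart])
  · refine ⟨M, P, fun l hl => ⟨?_, (hP l hl).2⟩, hconf⟩
    rw [(hP l hl).1, Function.update_of_ne (fun h : l = j => hj (h ▸ hl))]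

/-- The executor of task `i` can go first if no other one is at its goal. -/
lemma CanFinish.insert_task (hwf : I.WellFormed)
    (hstart : ∀ (i : Fin I.k) (a : Agent I.k),
      I.start a = I.taskStart i → a = (Role.initiator, i))
    {S : Finset (Fin I.k)} {c : Fin I.k → Role} {i : Fin I.k} (hi : i ∉ S)
    (hgoal : ∀ j ∈ S, I.start (c j, j) ≠ I.taskGoal i)
    (hc : I.CanFinish S c) : I.CanFinish (insert i S) c := by
  classical
  obtain ⟨M, P, hP, hconf⟩ := hc
  obtain ⟨w, hw⟩ := hwf.exists_walk_goal i (c i)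
  set e : Agent I.k := (Role.executor, i) with he
  set P' := Function.update P e (TimedPath.stay G (I.taskGoal i)) with hP'
  have hPe : P' e = TimedPath.stay G (I.taskGoal i) := by simp [hP']
  have hPne : ∀ j ∈ S, P' (Role.executor, j) = P (Role.executor, j) := by
    intro j hj
    refine Function.update_of_ne (fun h : (Role.executor, j) = e => hi ?_) _ _
    rw [he] at h
    simp only [Prod.mk.injEq, true_and] at h
    exact h ▸ hj
  have hset : executors (insert i S) = insert e (executors S) := by
    ext ⟨r, j⟩
    simp only [executors, Set.mem_ofPred_eq, Finset.mem_insert, Set.mem_insert_iff, he,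
      Prod.mk.injEq]
    tauto
  have hconf' : I.NoConflictOn M P' (executors (insert i S)) := by
    rw [hset]
    refine NoConflictOn.insert_stay (hconf.congr_paths ?_) (by rw [hPe]; rfl) ?_
    · rintro ⟨_, j⟩ ⟨rfl, hj⟩
      exact (hPne j hj).symm
    · rintro ⟨_, j⟩ ⟨rfl, hj⟩ _ h
      rw [hPne j hj, (hP j hj).1, hPe] at h
      exact absurd h (hgoal j hj)
  have h0 : (P' e).pos 0 = I.taskGoal i := by rw [hPe]; rfl
  have hS : ∀ a ∈ executors (insert i S), a ≠ e → a.1 = Role.executor ∧ a.2 ∈ S := by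
    rintro ⟨r, j⟩ ⟨h1, h2⟩ hne
    refine ⟨h1, (Finset.mem_insert.mp h2).resolve_left (fun h => hne ?_)⟩
    rw [he]
    exact Prod.ext h1 h
  have hpos : ∀ j ∈ S, (P' (Role.executor, j)).pos 0 = I.start (c j, j) := fun j hj => by
    rw [hPne j hj, (hP j hj).1]
  refine ⟨_, prependMove P' e w h0, fun l hl => ?_, hconf'.prependMove P' e w h0 ?_ ?_⟩
  · rcases Finset.mem_insert.mp hl with rfl | hl
    · refine ⟨pos_prependMove_self_zero _ _ _ _, ?_⟩
      rw [pos_len_prependMove, ← he, hPe]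
      rfl
    · have hne : (Role.executor, l) ≠ e := fun h => hi (by
        rw [he] at h
        simp only [Prod.mk.injEq, true_and] at h
        exact h ▸ hl)
      exact ⟨by rw [pos_prependMove_of_ne _ _ _ _ hne (Nat.zero_le _), hpos l hl],
        by rw [pos_len_prependMove, hPne l hl, (hP l hl).2]⟩
  · intro a ha b hb hab hae hbe
    exact CanFinish.pos_zero_ne hpos a (hS a ha hae) b (hS b hb hbe) hab
  · intro b hb hbe t _ heq
    obtain ⟨h1, h2⟩ := hS b hb hbe
    obtain ⟨_, j⟩ := b
    change _ = Role.executor at h1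
    subst h1
    have hmem := hw _ (w.getVert_mem_support t)
    rw [heq, hpos j h2] at hmem
    rcases hmem with hmem | hmem
    · have hji : j = i := hmem.eq_of_start hstart
      exact hi (hji ▸ h2)
    · exact hgoal j h2 hmem

/-- The executors can go to their goals one after the other. If the goal of the next one is occupied
by another executor, the latter first moves to the other agent start of its own task; so goals that
are occupied in a cyclic fashion do no harm. -/
lemma WellFormed.canFinish (hwf : I.WellFormed)
    (hstart : ∀ (i : Fin I.k) (a : Agent I.k),
      I.start a = I.taskStart i → a = (Role.initiator, i))
    (S : Finset (Fin I.k)) (c : Fin I.k → Role) : I.CanFinish S c := by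
  classical
  induction S using Finset.induction_on generalizing c with
  | empty =>
    exact ⟨fun i => ⟨I.taskStart i, 0⟩, fun a => TimedPath.stay G (I.start a), by simp,
      fun c hc => by simp [executors] at hc⟩
  | insert i S hi ih =>
    by_cases h : ∃ j ∈ S, I.start (c j, j) = I.taskGoal i
    · obtain ⟨j, hj, hg⟩ := h
      obtain ⟨r, hr⟩ : ∃ r, r ≠ c j := by
        cases c j
        exacts [⟨.executor, by simp⟩, ⟨.initiator, by simp⟩]
      refine CanFinish.of_update hwf hstart j r (CanFinish.insert_task hwf hstart hi ?_ (ih _))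
      intro l hl hgl
      have hlj := I.start_injective (hgl.trans hg.symm)
      obtain rfl : l = j := congrArg Prod.snd hlj
      simp at hlj
      exact hr hlj
    · push Not at h
      exact CanFinish.insert_task hwf hstart hi h (ih c)

/-- All executors, and the initiators of the tasks in `D`. -/
def executorsAnd {k : ℕ} (D : Finset (Fin k)) : Set (Agent k) :=
  {a | a.1 = Role.executor ∨ a.2 ∈ D}

/-- The initiators can go to their executors one after the other, before any executor moves. -/
lemma WellFormed.exists_paths (hwf : I.WellFormed)
    (hstart : ∀ (i : Fin I.k) (a : Agent I.k),
      I.start a = I.taskStart i → a = (Role.initiator, i)) (D : Finset (Fin I.k)) :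
    ∃ (M : Fin I.k → Meeting V) (P : Agent I.k → TimedPath G),
      (∀ i, (M i).loc = I.start (Role.executor, i)) ∧
      (∀ a ∈ executorsAnd D, (P a).pos 0 = I.start a ∧ I.Performs (M a.2) (P a) a) ∧
      I.NoConflictOn M P (executorsAnd D) := by
  classical
  induction D using Finset.induction_on with
  | empty =>
    obtain ⟨M, P, hP, hconf⟩ := hwf.canFinish hstart Finset.univ (fun _ => Role.executor)
    have hset : executorsAnd (∅ : Finset (Fin I.k)) = executors Finset.univ := by
      ext a; simp [executors, executorsAnd]
    rw [hset]
    refine ⟨fun i => ⟨I.start (Role.executor, i), 0⟩, P, fun _ => rfl, ?_,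
      hconf.congr_meetings ?_⟩
    · rintro ⟨_, j⟩ ⟨rfl, hj⟩
      exact ⟨(hP j hj).1, (hP j hj).1, Nat.zero_le _, (hP j hj).1, (hP j hj).2⟩
    · rintro ⟨_, j⟩ ⟨rfl, hj⟩ ⟨_, j'⟩ ⟨rfl, hj'⟩ hne (rfl : j = j')
      exact absurd rfl hne
  | insert i D hi ih =>
    obtain ⟨M, P, hloc, hP, hconf⟩ := ih
    obtain ⟨w, hw, hws, hwe⟩ := hwf.exists_walk_meeting hstart i
    let e : Agent I.k := (Role.initiator, i)
    have he : e = (Role.initiator, i) := rfl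
    have heD : e ∉ executorsAnd D := by simp [executorsAnd, he, hi]
    -- In the remaining schedule the initiator of task `i` meets its executor at time `0`.
    set M' := Function.update M i ⟨I.start (Role.executor, i), 0⟩ with hM'
    set P' := Function.update P e (TimedPath.stay G (I.start (Role.executor, i))) with hP'
    have hPe : P' e = TimedPath.stay G (I.start (Role.executor, i)) := by simp [hP']
    have hPne : ∀ a ∈ executorsAnd D, P' a = P a := fun a ha =>
      Function.update_of_ne (fun h : a = e => heD (h ▸ ha)) _ _
    have hMi : M' i = ⟨I.start (Role.executor, i), 0⟩ := by simp [hM']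
    have hset : executorsAnd (insert i D) = insert e (executorsAnd D) := by
      ext ⟨r, j⟩
      cases r <;> simp [executorsAnd, he]
    have hmem : ∀ a ∈ executorsAnd (insert i D), a ≠ e → a ∈ executorsAnd D := fun a ha hne => by
      rw [hset] at ha
      exact ha.resolve_left hne
    have hpos : ∀ a ∈ executorsAnd D, (P' a).pos 0 = I.start a := fun a ha => by
      rw [hPne a ha, (hP a ha).1]
    have hconf' : I.NoConflictOn M' P' (executorsAnd (insert i D)) := by
      rw [hset]
      refine NoConflictOn.insert_stay ((hconf.congr_paths fun a ha =>
        (hPne a ha).symm).congr_meetings ?_) (by rw [hPe]; rfl) ?_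
      · rintro ⟨r, j⟩ ha ⟨r', j'⟩ hb hne (rfl : j = j')
        refine (Function.update_of_ne (fun hji : j = i => ?_) _ _).symm
        subst hji
        cases r <;> cases r' <;> simp_all [executorsAnd]
      · intro b hb hbe h
        rw [hpos b hb, hPe] at h
        rw [I.start_injective h]
        exact ⟨rfl, by rw [he, hMi, hPe]; rfl⟩
    have h0 : (P' e).pos 0 = I.start (Role.executor, i) := by rw [hPe]; rfl
    refine ⟨_, prependMove P' e w h0, ?_, ?_, hconf'.prependMove P' e w h0 ?_ ?_⟩
    · intro j
      by_cases hj : j = i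
      · subst hj
        simp [shiftMeetings, hMi]
      · simp [shiftMeetings, hM', Function.update_of_ne hj, hloc]
    · intro a ha
      by_cases hae : a = e
      · subst hae
        refine ⟨pos_prependMove_self_zero _ _ _ _, pos_prependMove_self_zero _ _ _ _, ?_, ?_, ?_⟩
        · obtain ⟨n, hn, hle⟩ := SimpleGraph.Walk.mem_support_iff_exists_getVert.mp hws
          refine ⟨n, ?_, ?_⟩
          · exact hle.trans (Nat.le_add_right _ _)
          · rw [prependMove_self, TimedPath.pos_prepend_of_le _ _ _ hle, hn]
        · rw [len_prependMove, hPe]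
          simp [shiftMeetings, e, hMi, TimedPath.stay]
        · simp only [shiftMeetings, e, hMi]
          rw [pos_prependMove_add, h0]
      · have haD := hmem a ha hae
        have hz : (prependMove P' e w h0 a).pos 0 = I.start a := by
          rw [pos_prependMove_of_ne _ _ _ _ hae (Nat.zero_le _), hpos a haD]
        refine ⟨hz, ?_⟩
        have hperf := (hP a haD).2
        obtain ⟨_ | _, j⟩ := a
        · have hji : j ≠ i := fun h => hae (by rw [h])
          have hMj : M' j = M j := Function.update_of_ne hji _ _
          obtain ⟨-, ⟨t, ht, hts⟩, h3, h4⟩ := hperf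
          refine ⟨hz, ⟨w.length + t, ?_, ?_⟩, ?_, ?_⟩
          · simp only [shiftMeetings, hMj]
            exact Nat.add_le_add_left ht _
          · rw [pos_prependMove_add, hPne _ haD, hts]
          · rw [len_prependMove, hPne _ haD, h3]
            simp only [shiftMeetings, hMj]
          · simp only [shiftMeetings, hMj]
            rw [pos_prependMove_add, hPne _ haD, h4]
        · have hMperf : I.Performs (M' j) (P (Role.executor, j)) (Role.executor, j) := by
            by_cases hji : j = i
            · subst hji
              rw [hMi]
              exact ⟨hperf.1, Nat.zero_le _, hperf.1, hperf.2.2.2⟩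
            · rwa [show M' j = M j from Function.update_of_ne hji _ _]
          obtain ⟨-, h2, h3, h4⟩ := hMperf
          refine ⟨hz, ?_, ?_, ?_⟩
          · rw [len_prependMove, hPne _ haD]
            exact Nat.add_le_add_left h2 _
          · simp only [shiftMeetings]
            rw [pos_prependMove_add, hPne _ haD, h3]
          · rw [pos_len_prependMove, hPne _ haD, h4]
    · intro a ha b hb hab hae hbe
      rw [hpos a (hmem a ha hae), hpos b (hmem b hb hbe)]
      exact fun h => hab (I.start_injective h)
    · intro b hb hbe t ht heq
      rw [hpos b (hmem b hb hbe)] at heq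
      have hpriv := hw _ (w.getVert_mem_support t)
      rw [heq] at hpriv
      have hb2 := hpriv.eq_of_start hstart
      obtain ⟨_ | _, j⟩ := b
      · change j = i at hb2
        exact hbe (by rw [hb2])
      · change j = i at hb2
        exact hwe t ht (by rw [heq, hb2])

theorem WellFormed.exists_isSolution (hwf : I.WellFormed)
    (hstart : ∀ (i : Fin I.k) (a : Agent I.k),
      I.start a = I.taskStart i → a = (Role.initiator, i)) :
    ∃ P : Agent I.k → TimedPath G, I.IsSolution P := by
  obtain ⟨M, P, -, hP, hconf⟩ := hwf.exists_paths hstart Finset.univ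
  have huniv : ∀ a : Agent I.k, a ∈ executorsAnd (Finset.univ : Finset (Fin I.k)) := fun a =>
    Or.inr (Finset.mem_univ _)
  exact ⟨P, M, fun a => (hP a (huniv a)).2, fun c => hconf c (huniv _) (huniv _)⟩

end CoMAPF

namespace CoMAPF

variable {V : Type*} {G : SimpleGraph V} {I : CoMAPF G}

/-! ### Unconstrained paths and the cost of meetings -/

instance : Finite Role :=
  Finite.of_surjective (fun b : Bool => if b then Role.initiator else Role.executor) (by
    rintro (_ | _)
    exacts [⟨true, rfl⟩, ⟨false, rfl⟩])

lemma exists_performs_initiator {i : Fin I.k} {m : Meeting V} (h : I.earliest i m.loc ≤ m.time) :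
    ∃ p : TimedPath G, I.Performs m p (Role.initiator, i) ∧ p.len = m.time := by
  have hsum := (le_max_left _ _).trans h
  have htop := ne_top_of_le_ne_top (ENat.natCast_ne_top _) hsum
  obtain ⟨w₁, h₁⟩ := SimpleGraph.exists_walk_of_edist_ne_top (ne_top_of_le_ne_top htop le_self_add)
  obtain ⟨w₂, h₂⟩ := SimpleGraph.exists_walk_of_edist_ne_top (ne_top_of_le_ne_top htop le_add_self)
  rw [← h₁, ← h₂] at hsum
  have hle : w₁.length + w₂.length ≤ m.time := by exact_mod_cast hsum
  let p₂ := TimedPath.prepend w₂ (TimedPath.stay G m.loc) rfl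
  have hp₂ : p₂.pos 0 = I.taskStart i := TimedPath.pos_prepend_zero _ _ _
  let p₁ := TimedPath.prepend w₁ p₂ hp₂
  have hp₁ : p₁.pos 0 = I.start (Role.initiator, i) := TimedPath.pos_prepend_zero _ _ _
  obtain ⟨n, hn⟩ := Nat.exists_eq_add_of_le' hle
  have hlen : (p₁.delay n).len = m.time := by
    rw [hn]
    rfl
  refine ⟨p₁.delay n, ⟨?_, ⟨n + w₁.length, by omega, ?_⟩, hlen, ?_⟩, hlen⟩
  · rw [TimedPath.pos_delay_of_le _ (Nat.zero_le _), hp₁]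
  · rw [TimedPath.pos_delay_add]
    exact TimedPath.pos_prepend_length _ _ _
  · rw [hn, TimedPath.pos_delay_add, TimedPath.pos_prepend_add]
    exact TimedPath.pos_prepend_length _ _ _

lemma exists_performs_executor {i : Fin I.k} {m : Meeting V} (h : I.earliest i m.loc ≤ m.time)
    (hg : G.edist m.loc (I.taskGoal i) ≠ ⊤) :
    ∃ p : TimedPath G, I.Performs m p (Role.executor, i) ∧
      (p.len : ℕ∞) = m.time + G.edist m.loc (I.taskGoal i) := by
  have hle := (le_max_right _ _).trans h
  obtain ⟨w₁, h₁⟩ := SimpleGraph.exists_walk_of_edist_ne_top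
    (ne_top_of_le_ne_top (ENat.natCast_ne_top _) hle)
  obtain ⟨w₂, h₂⟩ := SimpleGraph.exists_walk_of_edist_ne_top hg
  rw [← h₁] at hle
  have hle : w₁.length ≤ m.time := by exact_mod_cast hle
  let p₂ := TimedPath.prepend w₂ (TimedPath.stay G (I.taskGoal i)) rfl
  have hp₂ : p₂.pos 0 = m.loc := TimedPath.pos_prepend_zero _ _ _
  let p₁ := TimedPath.prepend w₁ p₂ hp₂
  have hp₁ : p₁.pos 0 = I.start (Role.executor, i) := TimedPath.pos_prepend_zero _ _ _
  obtain ⟨n, hn⟩ := Nat.exists_eq_add_of_le' hle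
  have hlen : (p₁.delay n).len = m.time + w₂.length := by
    rw [hn, add_assoc]
    rfl
  refine ⟨p₁.delay n, ⟨?_, by omega, ?_, ?_⟩, ?_⟩
  · rw [TimedPath.pos_delay_of_le _ (Nat.zero_le _), hp₁]
  · rw [hn, TimedPath.pos_delay_add]
    exact TimedPath.pos_prepend_length _ _ _
  · rw [hlen, hn, add_assoc, TimedPath.pos_delay_add, TimedPath.pos_prepend_add]
    exact TimedPath.pos_prepend_length _ _ _
  · rw [hlen, ← h₂, Nat.cast_add]

lemma meetingCost_of_le {i : Fin I.k} {v : V} {t : ℕ∞} (h : I.earliest i v ≤ t) :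
    I.meetingCost i v t = 2 * t + G.edist v (I.taskGoal i) := if_pos h

lemma earliest_le_of_meetingCost_lt_top {i : Fin I.k} {v : V} {t : ℕ∞}
    (h : I.meetingCost i v t < ⊤) : I.earliest i v ≤ t := by
  by_contra hc
  rw [meetingCost, if_neg hc] at h
  exact h.ne rfl

lemma ne_top_of_meetingCost_lt_top {i : Fin I.k} {v : V} {t : ℕ∞}
    (h : I.meetingCost i v t < ⊤) : t ≠ ⊤ ∧ G.edist v (I.taskGoal i) ≠ ⊤ := by
  rw [meetingCost_of_le (earliest_le_of_meetingCost_lt_top h)] at h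
  constructor
  · rintro rfl
    simp [ENat.mul_top] at h
  · intro h'
    simp [h'] at h

/-- The earliest possible time of a meeting is a lower bound for its time in any schedule. -/
lemma earliest_le_of_performs {i : Fin I.k} {m : Meeting V} {p q : TimedPath G}
    (hp : I.Performs m p (Role.initiator, i)) (hq : I.Performs m q (Role.executor, i)) :
    I.earliest i m.loc ≤ m.time := by
  obtain ⟨h1, ⟨t, ht, h2⟩, h3, h4⟩ := hp
  obtain ⟨h5, h6, h7, -⟩ := hq
  refine max_le ?_ ?_
  · obtain ⟨s, hs⟩ := Nat.exists_eq_add_of_le ht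
    have e1 := p.edist_pos_le 0 t (by omega)
    have e2 := p.edist_pos_le t s (by omega)
    rw [zero_add, h1, h2] at e1
    rw [← hs, h2, h4] at e2
    rw [hs, Nat.cast_add]
    exact add_le_add e1 e2
  · have e := q.edist_pos_le 0 m.time (by omega)
    rwa [zero_add, h5, h7] at e

lemma meetingCost_le_of_performs {i : Fin I.k} {m : Meeting V} {p q : TimedPath G}
    (hp : I.Performs m p (Role.initiator, i)) (hq : I.Performs m q (Role.executor, i)) :
    I.meetingCost i m.loc m.time ≤ (p.len + q.len : ℕ) := by
  rw [meetingCost_of_le (earliest_le_of_performs hp hq)]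
  obtain ⟨-, -, h3, -⟩ := hp
  obtain ⟨-, h6, h7, h8⟩ := hq
  obtain ⟨s, hs⟩ := Nat.exists_eq_add_of_le h6
  have e := q.edist_pos_le m.time s (by omega)
  rw [h7, ← hs, h8] at e
  rw [h3, hs, two_mul]
  push_cast
  rw [← add_assoc]
  gcongr

/-! ### Plans -/

lemma exists_isPlan {m : Meeting V} {K : Set (Constraint V I.k)} {a : Agent I.k}
    {q : TimedPath G} (hq : I.Performs m q a) (hK : ∀ κ ∈ K, q.Satisfies a κ) :
    ∃ p, I.IsPlan m K a p := by
  obtain ⟨p, hp, hmin⟩ := (measure TimedPath.len).wf.has_min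
    {q : TimedPath G | I.Performs m q a ∧ ∀ κ ∈ K, q.Satisfies a κ} ⟨q, hq, hK⟩
  exact ⟨p, hp, fun q hq hK => not_lt.mp (hmin q ⟨hq, hK⟩)⟩

lemma exists_isPlan_of_meetingCost_lt_top {i : Fin I.k} {m : Meeting V}
    (h : I.meetingCost i m.loc m.time < ⊤) (a : Agent I.k) (ha : a.2 = i) :
    ∃ p, I.IsPlan m ∅ a p := by
  have he := earliest_le_of_meetingCost_lt_top h
  obtain ⟨_ | _, j⟩ := a <;> obtain rfl : j = i := ha
  · obtain ⟨p, hp, -⟩ := exists_performs_initiator he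
    exact exists_isPlan hp (by simp)
  · obtain ⟨p, hp, -⟩ := exists_performs_executor he (ne_top_of_meetingCost_lt_top h).2
    exact exists_isPlan hp (by simp)

/-- Without constraints, the cost of a meeting is attained by the planned paths. -/
lemma IsPlan.len_add_len_le {i : Fin I.k} {m : Meeting V} {p q : TimedPath G}
    (hp : I.IsPlan m ∅ (Role.initiator, i) p) (hq : I.IsPlan m ∅ (Role.executor, i) q) :
    ((p.len + q.len : ℕ) : ℕ∞) ≤ I.meetingCost i m.loc m.time := by
  have he := earliest_le_of_performs hp.1.1 hq.1.1
  by_cases hg : G.edist m.loc (I.taskGoal i) = ⊤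
  · rw [meetingCost_of_le he, hg]
    simp
  · obtain ⟨p', hp', hpl⟩ := exists_performs_initiator he
    obtain ⟨q', hq', hql⟩ := exists_performs_executor he hg
    have h1 := hp.2 p' hp' (by simp)
    have h2 := hq.2 q' hq' (by simp)
    rw [meetingCost_of_le he, two_mul, add_assoc, ← hql, ← hpl]
    exact_mod_cast add_le_add h1 h2

/-- A constraint on another agent does not change the plans of an agent. -/
lemma IsPlan.insert_constraint {m : Meeting V} {K : Set (Constraint V I.k)} {a : Agent I.k}
    {p : TimedPath G} {κ : Constraint V I.k} (h : I.IsPlan m K a p)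
    (hκ : ∀ q : TimedPath G, q.Satisfies a κ) : I.IsPlan m (insert κ K) a p := by
  refine ⟨⟨h.1.1, ?_⟩, fun q hq hK => h.2 q hq fun κ' h' => hK κ' (Or.inr h')⟩
  rintro κ' (rfl | h')
  exacts [hκ p, h.1.2 κ' h']

/-! ### Meetings tables -/

/-- Get-next-meeting returns a meeting whenever some entry of the table has finite cost. -/
lemma exists_nextMeeting [Finite V] {i : Fin I.k} {T : V → ℕ∞} {v : V}
    (hv : I.meetingCost i v (T v) < ⊤) : ∃ m T', I.NextMeeting i T m T' := by
  classical
  have : Nonempty V := ⟨v⟩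
  obtain ⟨u, hu⟩ := Finite.exists_min fun v => I.meetingCost i v (T v)
  have hlt := (hu v).trans_lt hv
  obtain ⟨t, ht⟩ := ENat.ne_top_iff_exists.mp (ne_top_of_meetingCost_lt_top hlt).1
  exact ⟨⟨u, t⟩, Function.update T u (T u + 1), ht.symm, hlt, hu, by simp,
    fun v hv => Function.update_of_ne hv _ _⟩

lemma NextMeeting.le {i : Fin I.k} {T T' : V → ℕ∞} {m : Meeting V}
    (h : I.NextMeeting i T m T') (v : V) : T v ≤ T' v := by
  obtain ⟨-, -, -, h4, h5⟩ := h
  by_cases hv : v = m.loc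
  · rw [hv, h4]
    exact le_self_add
  · rw [h5 v hv]

lemma NextMeeting.meetingCost_lt_top {i : Fin I.k} {T T' : V → ℕ∞} {m : Meeting V}
    (h : I.NextMeeting i T m T') : I.meetingCost i m.loc m.time < ⊤ := by
  rw [← h.1]
  exact h.2.1

variable (I) in
/-- The meeting `m` has been returned last from the table, which is now `T'`, or it still lies ahead
and the meeting `m₀` that has been returned last is not more expensive. -/
def Ahead (i : Fin I.k) (m : Meeting V) (m₀ : Meeting V) (T' : V → ℕ∞) : Prop :=
  m₀ = m ∨ (T' m.loc ≤ m.time ∧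
    I.meetingCost i m₀.loc m₀.time ≤ I.meetingCost i m.loc m.time)

lemma meetingCost_mono {i : Fin I.k} {v : V} {t t' : ℕ∞} (h : I.earliest i v ≤ t)
    (ht : t ≤ t') : I.meetingCost i v t ≤ I.meetingCost i v t' := by
  rw [meetingCost_of_le h, meetingCost_of_le (h.trans ht)]
  gcongr

/-- Get-next-meeting does not skip any meeting. -/
lemma NextMeeting.ahead {i : Fin I.k} {T T' : V → ℕ∞} {m m₀ : Meeting V}
    (h : I.NextMeeting i T m₀ T') (hT : ∀ v, I.earliest i v ≤ T v)
    (hm : T m.loc ≤ m.time) : I.Ahead i m m₀ T' := by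
  obtain ⟨h1, h2, h3, h4, h5⟩ := h
  have hcost : I.meetingCost i m₀.loc m₀.time ≤ I.meetingCost i m.loc m.time := by
    rw [← h1]
    exact (h3 m.loc).trans (meetingCost_mono (hT _) hm)
  by_cases hl : m.loc = m₀.loc
  · rw [hl, h1] at hm
    have hm : m₀.time ≤ m.time := by exact_mod_cast hm
    rcases hm.eq_or_lt with ht | ht
    · left
      cases m
      cases m₀
      simp_all
    · refine Or.inr ⟨?_, hcost⟩
      rw [hl, h4, h1]
      exact_mod_cast ht
  · exact Or.inr ⟨by rwa [h5 _ hl], hcost⟩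

end CoMAPF

/-- The time step of a constraint. -/
def Constraint.time {V : Type*} {k : ℕ} : Constraint V k → ℕ
  | vertex _ _ t => t
  | edge _ _ _ t => t

lemma Constraint.finite_setOf_time_le {V : Type*} [Finite V] {k : ℕ} (C : ℕ) :
    {κ : Constraint V k | κ.time ≤ C}.Finite := by
  refine ((Set.finite_range fun x : Agent k × V × Fin (C + 1) =>
      Constraint.vertex x.1 x.2.1 x.2.2).union
    (Set.finite_range fun x : Agent k × V × V × Fin (C + 1) =>
      Constraint.edge x.1 x.2.1 x.2.2.1 x.2.2.2)).subset ?_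
  rintro (⟨a, v, t⟩ | ⟨a, u, v, t⟩) ht
  · exact Or.inl ⟨⟨a, v, ⟨t, Nat.lt_succ_of_le ht⟩⟩, rfl⟩
  · exact Or.inr ⟨⟨a, u, v, ⟨t, Nat.lt_succ_of_le ht⟩⟩, rfl⟩

namespace CoMAPF

variable {V : Type*} {G : SimpleGraph V} {I : CoMAPF G}

/-! ### Invariant of the open nodes -/

/-- What holds for every open node: its paths are plans for its constraints, and a root node has no
constraints and has meetings tables without entries below the earliest times. -/
structure Node.Valid (N : I.Node) : Prop where
  plan : ∀ a : Agent I.k, I.IsPlan (N.meetings a.2) N.constraints a (N.paths a)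
  constraints_eq : N.isRoot = true → N.constraints = ∅
  earliest_le : N.isRoot = true → ∀ i v, I.earliest i v ≤ N.tables i v

lemma IsInitialRoot.valid {R : I.Node} (h : IsInitialRoot R) : R.Valid := by
  obtain ⟨h1, h2, h3, h4⟩ := h
  exact ⟨fun a => by rw [h1]; exact h4 a, fun _ => h1, fun _ i v => (h2 i).le v⟩

lemma Node.Valid.rootSuccessor {N R : I.Node} {i : Fin I.k} (hN : N.Valid)
    (hroot : N.isRoot = true) (h : IsRootSuccessor N i R) : R.Valid := by
  obtain ⟨h1, h2, h3, h4, h5⟩ := h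
  refine ⟨fun a => ?_, fun _ => h1, fun _ j v => ?_⟩
  · rw [h1]
    by_cases ha : a.2 = i
    · rw [ha]
      exact (h5 a).1 ha
    · rw [(h3 a.2 ha).1, (h5 a).2 ha, ← hN.constraints_eq hroot]
      exact hN.plan a
  · by_cases hj : j = i
    · subst hj
      exact (hN.earliest_le hroot j v).trans (h2.le v)
    · rw [(h3 j hj).2]
      exact hN.earliest_le hroot j v

lemma Node.Valid.splitSuccessor {N A : I.Node} {a : Agent I.k} {κ : Constraint V I.k}
    (hN : N.Valid) (hκ : ∀ b, b ≠ a → ∀ q : TimedPath G, q.Satisfies b κ)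
    (h : IsSplitSuccessor N a κ A) : A.Valid := by
  obtain ⟨h1, h2, h3, h4, h5, h6⟩ := h
  refine ⟨fun b => ?_, fun hr => by simp [h4] at hr, fun hr => by simp [h4] at hr⟩
  by_cases hb : b = a
  · rw [hb, h2]
    exact h5
  · rw [h2, h6 b hb, h1]
    exact (hN.plan b).insert_constraint (hκ b hb)

lemma satisfies_fstConstraint_of_ne (c : Conflict V I.k) {b : Agent I.k} (hb : b ≠ c.fstAgent)
    (q : TimedPath G) : q.Satisfies b c.fstConstraint := by
  cases c <;> exact fun h => absurd h.symm hb

lemma satisfies_sndConstraint_of_ne (c : Conflict V I.k) {b : Agent I.k} (hb : b ≠ c.sndAgent)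
    (q : TimedPath G) : q.Satisfies b c.sndConstraint := by
  cases c <;> exact fun h => absurd h.symm hb

lemma HasConflict.not_satisfies_fst {M : Fin I.k → Meeting V} {P : Agent I.k → TimedPath G}
    {c : Conflict V I.k} (h : I.HasConflict M P c) :
    ¬ (P c.fstAgent).Satisfies c.fstAgent c.fstConstraint := by
  cases c with
  | vertex a b v t => exact fun hs => hs rfl h.2.1
  | edge a b u v t => exact fun hs => hs rfl h.2.1

lemma HasConflict.not_satisfies_snd {M : Fin I.k → Meeting V} {P : Agent I.k → TimedPath G}
    {c : Conflict V I.k} (h : I.HasConflict M P c) :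
    ¬ (P c.sndAgent).Satisfies c.sndAgent c.sndConstraint := by
  cases c with
  | vertex a b v t => exact fun hs => hs rfl h.2.2.1
  | edge a b u v t => exact fun hs => hs rfl h.2.2

/-- Conflict-free paths satisfy one of the two constraints on which a node with the same meetings is
split. -/
lemma HasConflict.satisfies_or {M : Fin I.k → Meeting V} {P Q : Agent I.k → TimedPath G}
    {c : Conflict V I.k} (h : I.HasConflict M P c) (hQ : ∀ c, ¬ I.HasConflict M Q c) :
    (Q c.fstAgent).Satisfies c.fstAgent c.fstConstraint ∨
      (Q c.sndAgent).Satisfies c.sndAgent c.sndConstraint := by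
  by_contra! hc
  obtain ⟨h1, h2⟩ := hc
  cases c with
  | vertex a b v t =>
    refine hQ (.vertex a b v t) ⟨h.1, ?_, ?_, h.2.2.2⟩
    · by_contra h3; exact h1 fun _ => h3
    · by_contra h3; exact h2 fun _ => h3
  | edge a b u v t =>
    refine hQ (.edge a b u v t) ⟨h.1, ?_, ?_⟩
    · by_contra h3; exact h1 fun _ => h3
    · by_contra h3; exact h2 fun _ => h3

/-! ### The cost of nodes -/

lemma len_le_soc (P : Agent I.k → TimedPath G) (a : Agent I.k) : (P a).len ≤ I.soc P := by
  have h := Finset.single_le_sum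
    (f := fun i => (P (Role.initiator, i)).len + (P (Role.executor, i)).len)
    (fun _ _ => Nat.zero_le _) (Finset.mem_univ a.2)
  obtain ⟨_ | _, i⟩ := a <;> simp only [soc] at h ⊢ <;> omega

lemma Node.Valid.meeting_time_le {N : I.Node} (hN : N.Valid) (i : Fin I.k) :
    (N.meetings i).time ≤ N.cost := by
  rw [← (hN.plan (Role.initiator, i)).1.1.2.2.1]
  exact len_le_soc _ _

lemma Node.HasConflict.time_le {N : I.Node} {c : Conflict V I.k} (h : N.HasConflict c) :
    c.fstConstraint.time ≤ N.cost ∧ c.sndConstraint.time ≤ N.cost := by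
  cases c with
  | vertex a b v t =>
    have := h.2.1.1.trans (len_le_soc N.paths a)
    exact ⟨this, this⟩
  | edge a b u v t =>
    have := h.2.1.2.1.le.trans (len_le_soc N.paths a)
    exact ⟨this, this⟩

/-! ### Completeness: some open node leads to a given solution -/

/-- The search from the node `N` can still reach the meetings `M` with the paths `P`: either `N` has
these meetings and its constraints admit `P`, or `N` is a root node from which the meetings tables
lead to `M`. -/
def Node.LeadsTo (M : Fin I.k → Meeting V) (P : Agent I.k → TimedPath G) (N : I.Node) : Prop :=
  (N.meetings = M ∧ ∀ a, ∀ κ ∈ N.constraints, (P a).Satisfies a κ) ∨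
  (N.isRoot = true ∧ ∀ i, I.Ahead i (M i) (N.meetings i) (N.tables i))

section Completeness

variable {M : Fin I.k → Meeting V} {P : Agent I.k → TimedPath G}

lemma Node.LeadsTo.cost_le {N : I.Node} (h : N.LeadsTo M P) (hN : N.Valid)
    (hP : ∀ a : Agent I.k, I.Performs (M a.2) (P a) a) : N.cost ≤ I.soc P := by
  unfold Node.cost soc
  refine Finset.sum_le_sum fun i _ => ?_
  rcases h with ⟨rfl, h⟩ | ⟨hr, h⟩
  · exact add_le_add ((hN.plan _).2 _ (hP _) (h _)) ((hN.plan _).2 _ (hP _) (h _))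
  · have hplan := hN.plan
    rw [hN.constraints_eq hr] at hplan
    have h1 := (hplan (Role.initiator, i)).len_add_len_le (hplan (Role.executor, i))
    have h2 := meetingCost_le_of_performs (hP (Role.initiator, i)) (hP (Role.executor, i))
    have h3 : I.meetingCost i (N.meetings i).loc (N.meetings i).time ≤
        I.meetingCost i (M i).loc (M i).time := by
      rcases h i with h | h
      · rw [h]
      · exact h.2
    exact_mod_cast (h1.trans h3).trans h2

lemma IsInitialRoot.leadsTo {R : I.Node} (h : IsInitialRoot R)
    (hP : ∀ a : Agent I.k, I.Performs (M a.2) (P a) a) : R.LeadsTo M P :=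
  Or.inr ⟨h.2.2.1, fun i => (h.2.1 i).ahead (fun _ => le_rfl)
    (earliest_le_of_performs (hP (Role.initiator, i)) (hP (Role.executor, i)))⟩

lemma exists_rootSuccessor [Finite V] {N : I.Node} {i : Fin I.k} {v : V}
    (hv : I.meetingCost i v (N.tables i v) < ⊤) :
    ∃ R, IsRootSuccessor N i R := by
  classical
  obtain ⟨m, T, hm⟩ := exists_nextMeeting hv
  have hpaths : ∀ a : Agent I.k, ∃ p : TimedPath G,
      (a.2 = i → I.IsPlan m ∅ a p) ∧ (a.2 ≠ i → p = N.paths a) := fun a => by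
    by_cases ha : a.2 = i
    · obtain ⟨p, hp⟩ := exists_isPlan_of_meetingCost_lt_top hm.meetingCost_lt_top a ha
      exact ⟨p, fun _ => hp, fun h => absurd ha h⟩
    · exact ⟨N.paths a, fun h => absurd h ha, fun _ => rfl⟩
  choose p hp using hpaths
  exact ⟨⟨∅, Function.update N.meetings i m, Function.update N.tables i T, true, p⟩, rfl,
    by simpa using hm, fun j hj => by simp [hj], rfl, by simpa using hp⟩

/-- A node that leads to a conflict-free family of paths has a successor that does so too. -/
lemma Node.LeadsTo.exists_successor [Finite V] {N : I.Node} (h : N.LeadsTo M P) (hN : N.Valid)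
    (hP : ∀ a : Agent I.k, I.Performs (M a.2) (P a) a) (hconf : ∀ c, ¬ I.HasConflict M P c)
    {c : Conflict V I.k} (hc : N.HasConflict c) {newReg newRoots : Multiset I.Node}
    (hroots : (N.isRoot = true ∧ ExpandRoot N newRoots) ∨ (N.isRoot = false ∧ newRoots = 0))
    (hsplit : Split N c newReg) : ∃ A ∈ newReg + newRoots, A.LeadsTo M P := by
  by_cases hM : N.meetings = M
  · have hsat : ∀ a, ∀ κ ∈ N.constraints, (P a).Satisfies a κ := by
      rcases h with h | h
      · exact h.2
      · simp [hN.constraints_eq h.1]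
    -- The successor for the constraint `κ` on agent `b` exists since `P b` satisfies it.
    have key : ∀ (b : Agent I.k) (κ : Constraint V I.k) (S : Multiset I.Node),
        OneIfPossible (IsSplitSuccessor N b κ) S → (∀ a, (P a).Satisfies a κ) →
        ∃ A ∈ S, A.LeadsTo M P := by
      classical
      intro b κ S hS hκ
      have hins : ∀ a, ∀ κ' ∈ insert κ N.constraints, (P a).Satisfies a κ' := by
        rintro a κ' (rfl | h')
        exacts [hκ a, hsat a κ' h']
      rcases hS with ⟨A, hA, rfl⟩ | ⟨hA, -⟩
      · refine ⟨A, Multiset.mem_singleton_self A, Or.inl ⟨hA.2.1.trans hM, ?_⟩⟩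
        rw [hA.1]
        exact hins
      · have hperf := hP b
        rw [← hM] at hperf
        obtain ⟨p, hp⟩ := exists_isPlan hperf (hins b)
        refine absurd ⟨⟨insert κ N.constraints, N.meetings, N.tables, false,
          Function.update N.paths b p⟩, rfl, rfl, rfl, rfl, by simpa using hp, fun a ha => ?_⟩ hA
        simp [ha]
    obtain ⟨S₁, S₂, h₁, h₂, rfl⟩ := hsplit
    have hc' : I.HasConflict M N.paths c := hM ▸ hc
    rcases hc'.satisfies_or hconf with hs | hs
    · obtain ⟨A, hA, hAl⟩ := key _ _ _ h₁ fun a => by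
        by_cases ha : a = c.fstAgent
        · rw [ha]; exact hs
        · exact satisfies_fstConstraint_of_ne c ha _
      exact ⟨A, by simp [hA], hAl⟩
    · obtain ⟨A, hA, hAl⟩ := key _ _ _ h₂ fun a => by
        by_cases ha : a = c.sndAgent
        · rw [ha]; exact hs
        · exact satisfies_sndConstraint_of_ne c ha _
      exact ⟨A, by simp [hA], hAl⟩
  · obtain ⟨hr, hah⟩ := h.resolve_left fun h => hM h.1
    obtain ⟨i, hi⟩ : ∃ i, N.meetings i ≠ M i := by
      by_contra! hall
      exact hM (funext hall)
    have hT := ((hah i).resolve_left hi).1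
    have hcost : I.meetingCost i (M i).loc (N.tables i (M i).loc) < ⊤ :=
      ((meetingCost_mono (hN.earliest_le hr i _) hT).trans (meetingCost_le_of_performs
        (hP (Role.initiator, i)) (hP (Role.executor, i)))).trans_lt (ENat.natCast_lt_top _)
    have hsucc := exists_rootSuccessor hcost
    rcases hroots with ⟨-, F, hF, rfl⟩ | ⟨hr', -⟩
    · rcases hF i with ⟨A, hA, hS⟩ | ⟨hA, -⟩
      · refine ⟨A, Multiset.mem_add.mpr (Or.inr (Multiset.mem_sum.mpr
          ⟨i, Finset.mem_univ i, by simp [hS]⟩)), Or.inr ⟨hA.2.2.2.1, fun j => ?_⟩⟩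
        by_cases hj : j = i
        · subst hj
          exact hA.2.1.ahead (hN.earliest_le hr j) hT
        · rw [(hA.2.2.1 j hj).1, (hA.2.2.1 j hj).2]
          exact hah j
      · exact absurd hsucc hA
    · simp [hr'] at hr

end Completeness

/-! ### Termination -/

/-- The meetings up to time `C` that the tables `T` have not yet returned. -/
def futureMeetings (C : ℕ) (T : Fin I.k → V → ℕ∞) : Set (Fin I.k × V × ℕ) :=
  {x | x.2.2 ≤ C ∧ T x.1 x.2.1 ≤ x.2.2}

lemma finite_futureMeetings [Finite V] (C : ℕ) (T : Fin I.k → V → ℕ∞) :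
    (futureMeetings C T).Finite := by
  refine (Set.finite_range fun x : Fin I.k × V × Fin (C + 1) =>
    ((x.1, x.2.1, (x.2.2 : ℕ)) : Fin I.k × V × ℕ)).subset ?_
  rintro ⟨i, v, t⟩ ⟨ht, -⟩
  exact ⟨⟨i, v, ⟨t, Nat.lt_succ_of_le ht⟩⟩, rfl⟩

/-- A bound for the depth of the search below a node as long as only nodes of cost at most `C` are
expanded: the number of meetings and of constraints up to time `C` that have not been used yet. -/
noncomputable def Node.depth (C : ℕ) (N : I.Node) : ℕ :=
  (futureMeetings C N.tables).ncard + ({κ | κ.time ≤ C} \ N.constraints).ncard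

lemma Node.Valid.depth_rootSuccessor [Finite V] {C : ℕ} {N R : I.Node} {i : Fin I.k}
    (hN : N.Valid) (hroot : N.isRoot = true) (h : IsRootSuccessor N i R) (hC : R.cost ≤ C) :
    R.depth C < N.depth C := by
  have htime := ((hN.rootSuccessor hroot h).meeting_time_le i).trans hC
  obtain ⟨h1, h2, h3, -, -⟩ := h
  rw [Node.depth, Node.depth, h1, hN.constraints_eq hroot]
  refine Nat.add_lt_add_right (Set.ncard_lt_ncard ?_ (finite_futureMeetings _ _)) _
  refine Set.ssubset_iff_subset_ne.mpr ⟨?_, fun heq => ?_⟩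
  · rintro ⟨j, v, t⟩ ⟨ht, hT⟩
    refine ⟨ht, le_trans ?_ hT⟩
    by_cases hj : j = i
    · subst hj
      exact h2.le v
    · exact (h3 j hj).2 ▸ le_rfl
  · have hmem : (i, (R.meetings i).loc, (R.meetings i).time) ∈ futureMeetings C N.tables :=
      ⟨htime, h2.1.le⟩
    rw [← heq] at hmem
    have hlt := hmem.2
    simp only [h2.2.2.2.1, h2.1] at hlt
    have hlt : (R.meetings i).time + 1 ≤ (R.meetings i).time := by exact_mod_cast hlt
    omega

lemma Node.depth_splitSuccessor [Finite V] {C : ℕ} {N A : I.Node} {a : Agent I.k}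
    {κ : Constraint V I.k} (h : IsSplitSuccessor N a κ A) (hκ : κ ∉ N.constraints)
    (hC : κ.time ≤ C) : A.depth C < N.depth C := by
  rw [Node.depth, Node.depth, h.1, h.2.2.1]
  refine Nat.add_lt_add_left (Set.ncard_lt_ncard ?_
    ((Constraint.finite_setOf_time_le C).subset Set.sdiff_subset)) _
  refine Set.ssubset_iff_subset_ne.mpr ⟨Set.sdiff_subset_sdiff_right (Set.subset_insert _ _),
    fun heq => ?_⟩
  have hmem : κ ∈ {κ : Constraint V I.k | κ.time ≤ C} \ N.constraints := ⟨hC, hκ⟩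
  rw [← heq] at hmem
  exact hmem.2 (Set.mem_insert _ _)

open Classical in
/-- The weight of a node. A node has at most `I.k + 2` successors, and those of cost at most `C`
have smaller depth, so expanding it lowers the sum of the weights. Nodes of cost more than `C` are never
selected and need no weight. -/
noncomputable def Node.weight (C : ℕ) (N : I.Node) : ℕ :=
  if N.cost ≤ C then (I.k + 3) ^ N.depth C else 0

lemma OneIfPossible.card_le {Q : I.Node → Prop} {S : Multiset I.Node} (h : OneIfPossible Q S) :
    S.card ≤ 1 := by
  rcases h with ⟨A, -, rfl⟩ | ⟨-, rfl⟩ <;> simp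

lemma OneIfPossible.of_mem {Q : I.Node → Prop} {S : Multiset I.Node} (h : OneIfPossible Q S)
    {A : I.Node} (hA : A ∈ S) : Q A := by
  rcases h with ⟨B, hB, rfl⟩ | ⟨-, rfl⟩
  · rwa [Multiset.mem_singleton.mp hA]
  · simp at hA

lemma exists_oneIfPossible (Q : I.Node → Prop) : ∃ S, OneIfPossible Q S := by
  by_cases h : ∃ A, Q A
  · obtain ⟨A, hA⟩ := h
    exact ⟨{A}, Or.inl ⟨A, hA, rfl⟩⟩
  · exact ⟨0, Or.inr ⟨h, rfl⟩⟩

section Successors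

variable {N : I.Node} {c : Conflict V I.k} {newReg newRoots : Multiset I.Node}

lemma mem_successors
    (hroots : (N.isRoot = true ∧ ExpandRoot N newRoots) ∨ (N.isRoot = false ∧ newRoots = 0))
    (hsplit : Split N c newReg) {A : I.Node} (hA : A ∈ newReg + newRoots) :
    IsSplitSuccessor N c.fstAgent c.fstConstraint A ∨
      IsSplitSuccessor N c.sndAgent c.sndConstraint A ∨
      (N.isRoot = true ∧ ∃ i, IsRootSuccessor N i A) := by
  rcases Multiset.mem_add.mp hA with hA | hA
  · obtain ⟨S₁, S₂, h₁, h₂, rfl⟩ := hsplit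
    rcases Multiset.mem_add.mp hA with hA | hA
    · exact Or.inl (h₁.of_mem hA)
    · exact Or.inr (Or.inl (h₂.of_mem hA))
  · rcases hroots with ⟨hr, F, hF, rfl⟩ | ⟨-, rfl⟩
    · obtain ⟨i, -, hi⟩ := Multiset.mem_sum.mp hA
      exact Or.inr (Or.inr ⟨hr, i, (hF i).of_mem hi⟩)
    · simp at hA

lemma card_successors_le
    (hroots : (N.isRoot = true ∧ ExpandRoot N newRoots) ∨ (N.isRoot = false ∧ newRoots = 0))
    (hsplit : Split N c newReg) : (newReg + newRoots).card ≤ I.k + 2 := by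
  obtain ⟨S₁, S₂, h₁, h₂, rfl⟩ := hsplit
  have hr : newRoots.card ≤ I.k := by
    rcases hroots with ⟨-, F, hF, rfl⟩ | ⟨-, rfl⟩
    · rw [Multiset.card_sum]
      exact (Finset.sum_le_card_nsmul _ _ 1 fun i _ => (hF i).card_le).trans (by simp)
    · simp
  have := h₁.card_le
  have := h₂.card_le
  simp only [Multiset.card_add]
  omega

lemma Node.Valid.of_mem_successors (hN : N.Valid)
    (hroots : (N.isRoot = true ∧ ExpandRoot N newRoots) ∨ (N.isRoot = false ∧ newRoots = 0))
    (hsplit : Split N c newReg) {A : I.Node} (hA : A ∈ newReg + newRoots) : A.Valid := by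
  rcases mem_successors hroots hsplit hA with h | h | ⟨hr, i, h⟩
  · exact hN.splitSuccessor (fun b hb => satisfies_fstConstraint_of_ne c hb) h
  · exact hN.splitSuccessor (fun b hb => satisfies_sndConstraint_of_ne c hb) h
  · exact hN.rootSuccessor hr h

lemma Node.Valid.weight_successor [Finite V] (hN : N.Valid) (hc : N.HasConflict c) {C : ℕ}
    (hC : N.cost ≤ C)
    (hroots : (N.isRoot = true ∧ ExpandRoot N newRoots) ∨ (N.isRoot = false ∧ newRoots = 0))
    (hsplit : Split N c newReg) {A : I.Node} (hA : A ∈ newReg + newRoots) :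
    A.weight C * (I.k + 3) ≤ N.weight C := by
  by_cases hAC : A.cost ≤ C
  · have hdepth : A.depth C < N.depth C := by
      rcases mem_successors hroots hsplit hA with h | h | ⟨hr, i, h⟩
      · exact Node.depth_splitSuccessor h
          (fun hmem => HasConflict.not_satisfies_fst hc ((hN.plan _).1.2 _ hmem))
          (hc.time_le.1.trans hC)
      · exact Node.depth_splitSuccessor h
          (fun hmem => HasConflict.not_satisfies_snd hc ((hN.plan _).1.2 _ hmem))
          (hc.time_le.2.trans hC)
      · exact hN.depth_rootSuccessor hr h hAC
    rw [Node.weight, Node.weight, if_pos hAC, if_pos hC, ← pow_succ]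
    exact Nat.pow_le_pow_right (by omega) hdepth
  · rw [Node.weight, if_neg hAC, zero_mul]
    exact Nat.zero_le _

lemma Node.Valid.sum_weight_lt [Finite V] (hN : N.Valid) (hc : N.HasConflict c) {C : ℕ}
    (hC : N.cost ≤ C)
    (hroots : (N.isRoot = true ∧ ExpandRoot N newRoots) ∨ (N.isRoot = false ∧ newRoots = 0))
    (hsplit : Split N c newReg) :
    ((newReg + newRoots).map (Node.weight C)).sum < N.weight C := by
  have hpos : 0 < N.weight C := by
    rw [Node.weight, if_pos hC]
    positivity
  have hsum := Multiset.sum_le_card_nsmul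
    ((newReg + newRoots).map fun A => A.weight C * (I.k + 3)) (N.weight C) (by
      intro x hx
      obtain ⟨A, hA, rfl⟩ := Multiset.mem_map.mp hx
      exact hN.weight_successor hc hC hroots hsplit hA)
  rw [Multiset.sum_map_mul_right, Multiset.card_map, smul_eq_mul] at hsum
  have hlt : (newReg + newRoots).card < I.k + 3 :=
    Nat.lt_succ_of_le (card_successors_le hroots hsplit)
  refine Nat.lt_of_mul_lt_mul_right (a := I.k + 3) (hsum.trans_lt ?_)
  rw [mul_comm (N.weight C)]
  exact Nat.mul_lt_mul_of_pos_right hlt hpos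

end Successors

/-! ### Runs of the algorithm -/

lemma Selects.add_eq {reg roots reg' roots' : Multiset I.Node} {N : I.Node}
    (h : Selects reg roots N reg' roots') : reg + roots = N ::ₘ (reg' + roots') := by
  rcases h with ⟨rfl, rfl, -⟩ | ⟨rfl, rfl, -⟩ <;> simp

lemma Selects.cost_le {reg roots reg' roots' : Multiset I.Node} {N : I.Node}
    (h : Selects reg roots N reg' roots') {N' : I.Node} (hN' : N' ∈ reg + roots) :
    N.cost ≤ N'.cost := by
  rcases h with ⟨-, -, h1, h2⟩ | ⟨-, -, h1, h2⟩ <;> rcases Multiset.mem_add.mp hN' with h | h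
  exacts [h1 _ h, h2 _ h, (h2 _ h).le, h1 _ h]

lemma exists_selects {reg roots : Multiset I.Node} {N₀ : I.Node} (hN₀ : N₀ ∈ reg + roots) :
    ∃ N reg' roots', Selects reg roots N reg' roots' := by
  by_cases h : ∃ N ∈ reg, ∀ N' ∈ reg + roots, N.cost ≤ N'.cost
  · obtain ⟨N, hN, hmin⟩ := h
    obtain ⟨reg', rfl⟩ := Multiset.exists_cons_of_mem hN
    exact ⟨N, reg', roots, Or.inl ⟨rfl, rfl, fun N' h => hmin N' (Multiset.mem_add.mpr (Or.inl h)),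
      fun N' h => hmin N' (Multiset.mem_add.mpr (Or.inr h))⟩⟩
  · push Not at h
    obtain ⟨N, hN, hmin⟩ := (measure Node.cost).wf.has_min {N | N ∈ reg + roots} ⟨N₀, hN₀⟩
    have hmin : ∀ N' ∈ reg + roots, N.cost ≤ N'.cost := fun N' h => not_lt.mp (hmin N' h)
    have hreg : ∀ N' ∈ reg, N.cost < N'.cost := fun N' hN' => by
      obtain ⟨N'', h1, h2⟩ := h N' hN'
      exact (hmin N'' h1).trans_lt h2
    have hroot : N ∈ roots :=
      (Multiset.mem_add.mp hN).resolve_left fun h => (hreg N h).false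
    obtain ⟨roots', rfl⟩ := Multiset.exists_cons_of_mem hroot
    exact ⟨N, reg, roots', Or.inr ⟨rfl, rfl,
      fun N' h => hmin N' (Multiset.mem_add.mpr (Or.inr h)), hreg⟩⟩

/-- The invariant of the algorithm, for a given solution with meetings `M` and paths `P`. -/
def State.Invariant (M : Fin I.k → Meeting V) (P : Agent I.k → TimedPath G) : I.State → Prop
  | .searching reg roots =>
      (∀ N ∈ reg + roots, N.Valid) ∧ ∃ N ∈ reg + roots, N.LeadsTo M P
  | .returned Q => I.IsSolution Q

/-- The number that decreases in each iteration. -/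
noncomputable def State.weight (C : ℕ) : I.State → ℕ
  | .searching reg roots => ((reg + roots).map (Node.weight C)).sum + 1
  | .returned _ => 0

lemma Step.exists_of_invariant {M : Fin I.k → Meeting V} {P : Agent I.k → TimedPath G}
    {reg roots : Multiset I.Node} (h : State.Invariant M P (.searching reg roots)) :
    ∃ s', I.Step (.searching reg roots) s' := by
  obtain ⟨-, N₀, hN₀, -⟩ := h
  obtain ⟨N, reg', roots', hsel⟩ := exists_selects hN₀
  by_cases hgoal : ∀ c, ¬ N.HasConflict c
  · exact ⟨_, .finish hsel hgoal⟩
  · push Not at hgoal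
    obtain ⟨c, hc, hmin⟩ := (measure Conflict.time).wf.has_min {c | N.HasConflict c} hgoal
    have hfirst : N.IsFirstConflict c := ⟨hc, fun c' h => not_lt.mp (hmin c' h)⟩
    obtain ⟨S₁, h₁⟩ := exists_oneIfPossible (IsSplitSuccessor N c.fstAgent c.fstConstraint)
    obtain ⟨S₂, h₂⟩ := exists_oneIfPossible (IsSplitSuccessor N c.sndAgent c.sndConstraint)
    have hsplit : Split N c (S₁ + S₂) := ⟨S₁, S₂, h₁, h₂, rfl⟩
    cases hr : N.isRoot with
    | false => exact ⟨_, .expand hsel hfirst (Or.inr ⟨hr, rfl⟩) hsplit⟩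
    | true =>
      choose F hF using fun i => exists_oneIfPossible (IsRootSuccessor N i)
      exact ⟨_, .expand hsel hfirst (Or.inl ⟨hr, F, hF, rfl⟩) hsplit⟩

lemma Step.invariant [Finite V] {M : Fin I.k → Meeting V} {P : Agent I.k → TimedPath G}
    (hP : ∀ a : Agent I.k, I.Performs (M a.2) (P a) a) (hconf : ∀ c, ¬ I.HasConflict M P c)
    {s s' : I.State} (hstep : I.Step s s') (h : s.Invariant M P) :
    s'.Invariant M P ∧ s'.weight (I.soc P) < s.weight (I.soc P) := by
  cases hstep with
  | @finish reg roots reg' roots' N hsel hgoal =>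
    refine ⟨⟨N.meetings, fun a => ((h.1 N ?_).plan a).1.1, hgoal⟩, Nat.succ_pos _⟩
    simp [hsel.add_eq]
  | @expand reg roots reg' roots' newReg newRoots N c hsel hc hroots hsplit =>
    obtain ⟨hvalid, N₀, hN₀, hlead⟩ := h
    have hcost := (hsel.cost_le hN₀).trans (hlead.cost_le (hvalid N₀ hN₀) hP)
    rw [hsel.add_eq] at hvalid hN₀
    have hN := hvalid N (Multiset.mem_cons_self _ _)
    have hadd : reg' + newReg + (roots' + newRoots) = reg' + roots' + (newReg + newRoots) :=
      add_add_add_comm _ _ _ _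
    refine ⟨⟨?_, ?_⟩, ?_⟩
    · rw [hadd]
      intro A hA
      rcases Multiset.mem_add.mp hA with hA | hA
      · exact hvalid A (Multiset.mem_cons_of_mem hA)
      · exact hN.of_mem_successors hroots hsplit hA
    · rw [hadd]
      rcases Multiset.mem_cons.mp hN₀ with rfl | hN₀
      · obtain ⟨A, hA, hAl⟩ := hlead.exists_successor hN hP hconf hc.1 hroots hsplit
        exact ⟨A, Multiset.mem_add.mpr (Or.inr hA), hAl⟩
      · exact ⟨N₀, Multiset.mem_add.mpr (Or.inl hN₀), hlead⟩
    · have := hN.sum_weight_lt hc.1 hcost hroots hsplit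
      simp only [State.weight]
      rw [hadd, hsel.add_eq, Multiset.map_add, Multiset.sum_add, Multiset.map_cons,
        Multiset.sum_cons]
      omega

lemma exists_isInitialRoot [Finite V] {M : Fin I.k → Meeting V} {P : Agent I.k → TimedPath G}
    (hP : ∀ a : Agent I.k, I.Performs (M a.2) (P a) a) : ∃ R : I.Node, IsInitialRoot R := by
  have hnext : ∀ i, ∃ m T', I.NextMeeting i (I.earliest i) m T' := fun i => by
    have hp := hP (Role.initiator, i)
    have hq := hP (Role.executor, i)
    exact exists_nextMeeting (v := (M i).loc) (((meetingCost_mono le_rfl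
      (earliest_le_of_performs hp hq)).trans (meetingCost_le_of_performs hp hq)).trans_lt
        (ENat.natCast_lt_top _))
  choose m T hT using hnext
  choose p hp using fun a : Agent I.k =>
    exists_isPlan_of_meetingCost_lt_top (hT a.2).meetingCost_lt_top a rfl
  exact ⟨⟨∅, m, T, true, p⟩, rfl, hT, rfl, hp⟩

end CoMAPF

theorem mainTheorem2 {V : Type*} [Finite V] (G : SimpleGraph V) (I : CoMAPF G)
    (hwf : I.WellFormed)
    (hstart : ∀ (i : Fin I.k) (a : Agent I.k),
      I.start a = I.taskStart i → a = (Role.initiator, i)) :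
    (∃ s₀ : I.State, I.IsInitialState s₀) ∧
    ∀ s₀ : I.State, I.IsInitialState s₀ →
      (¬ ∃ run : ℕ → I.State, run 0 = s₀ ∧ ∀ n, I.Step (run n) (run (n + 1))) ∧
      ∀ s : I.State, Relation.ReflTransGen I.Step s₀ s →
        (∃ s' : I.State, I.Step s s') ∨
        ∃ P : Agent I.k → TimedPath G, s = .returned P ∧ I.IsSolution P := by
  obtain ⟨P, M, hP, hconf⟩ := hwf.exists_isSolution hstart
  have hinit : ∀ s₀ : I.State, I.IsInitialState s₀ → s₀.Invariant M P := by
    rintro _ ⟨R, hR, rfl⟩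
    refine ⟨fun N hN => ?_, R, by simp, hR.leadsTo hP⟩
    obtain rfl : N = R := by simpa using hN
    exact hR.valid
  refine ⟨?_, fun s₀ hs₀ => ⟨?_, fun s hs => ?_⟩⟩
  · obtain ⟨R, hR⟩ := CoMAPF.exists_isInitialRoot hP
    exact ⟨_, R, hR, rfl⟩
  · rintro ⟨run, h0, hrun⟩
    have hinv : ∀ n, (run n).Invariant M P := fun n => by
      induction n with
      | zero => rw [h0]; exact hinit s₀ hs₀
      | succ n ih => exact ((hrun n).invariant hP hconf ih).1
    exact not_strictAnti_of_wellFoundedLT (fun n => (run n).weight (I.soc P))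
      (strictAnti_nat_of_succ_lt fun n => ((hrun n).invariant hP hconf (hinv n)).2)
  · have hinv : s.Invariant M P := by
      induction hs with
      | refl => exact hinit s₀ hs₀
      | tail _ hstep ih => exact (hstep.invariant hP hconf ih).1
    cases s with
    | searching reg roots => exact Or.inl (CoMAPF.Step.exists_of_invariant hinv)
    | returned Q => exact Or.inr ⟨Q, rfl, hinv⟩
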